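/- Let $\mathbb K$ be a commutative ring containing $\mathbb Q$ and let $\Lambda=\mathbb K[p_1,p_2,p_3,\dots]$ be the ring of symmetric functions, generated by the power sums $p_r$. Let $s_\lambda\in\Lambda$ denote the Schur function of the partition $\lambda$, i.e. the element (with rational coefficients) that, for $p_r=\sum_i x_i^r$, equals $\sum_T x^{\mathrm{weight}(T)}$, the sum over all semistandard Young tableaux $T$ of shape $\lambda$. For $f=\sum_\mu c_\mu p_\mu\in\Lambda$ with $c_\mu\in\mathbb K$, and $g\in\Lambda$ with rational coefficients, the plethysm is $f[g]=\sum_\mu c_\mu\, p_{\mu_1}[g]\,p_{\mu_2}[g]\cdots$, where $g\mapsto p_r[g]$ is the $\mathbb Q$-algebra endomorphism of $\mathbb Q[p_1,p_2,\dots]$ with $p_s\mapsto p_{rs}$. Write $\lambda'$ for the conjugate of $\lambda$. A partition is called even if all its columns have even length, and a corner of a partition is a cell $(r,c)$ of it such that neither $(r+1,c)$ nor $(r,c+1)$ is a cell of it. Then for every integer $h\ge 2$, \begin{align*} s_{(h-1,1)}[s_{1^2}] &= \sum_{\mu\in\mathcal P_{2h}} s_\mu+\sum_{\nu\vdash 2h\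 \text{even}}(b_\nu-1)\,s_\nu,\\ s_{(h-1,1)}[s_{2}] &= \sum_{\mu\in\mathcal P_{2h}} s_{\mu'}+\sum_{\nu\vdash 2h\ \text{even}}(b_\nu-1)\,s_{\nu'}, \end{align*} where $\mathcal P_{2h}$ is the set of all partitions of $2h$ whose columns all have even length except exactly two, which have distinct odd lengths, and $b_\nu$ is the number of corners of $\nu$. -/

import Mathlib

open scoped BigOperators

noncomputable section

namespace SymmFn

/-! ### The ring of symmetric functions and plethysm -/

/-- The ring of symmetric functions `Λ = K[p₁, p₂, p₃, …]`; the variable `X r` is the power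
sum `p_r`. -/
abbrev Sym (K : Type*) [CommRing K] : Type _ := MvPolynomial ℕ+ K

/-- `p_r[g]`, for `g` with rational coefficients: the ring endomorphism of `ℚ[p₁, p₂, …]` with
`p_s ↦ p_{r s}`. -/
def powerSumPlethysm (r : ℕ+) (g : Sym ℚ) : Sym ℚ :=
  MvPolynomial.aeval (fun s : ℕ+ => (MvPolynomial.X (r * s) : Sym ℚ)) g

/-- The image in `Λ_K` of a symmetric function with rational coefficients. -/
def baseChange (K : Type*) [CommRing K] [Algebra ℚ K] (f : Sym ℚ) : Sym K :=
  MvPolynomial.map (algebraMap ℚ K) f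

/-- The plethysm `f[g] = ∑_μ c_μ p_{μ₁}[g] p_{μ₂}[g] ⋯`, where `f = ∑_μ c_μ p_μ` with `c_μ ∈ K`,
and `g` has rational coefficients. -/
def plethysm {K : Type*} [CommRing K] [Algebra ℚ K] (f : Sym K) (g : Sym ℚ) : Sym K :=
  MvPolynomial.aeval (fun r : ℕ+ => baseChange K (powerSumPlethysm r g)) f

/-! ### Schur functions -/

/-- The power sum `∑_i x_i ^ r` as a formal power series in the variables `x₀, x₁, x₂, …`. -/
def powerSumSeries (r : ℕ+) : MvPowerSeries ℕ ℚ := by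
  classical
  exact fun d => if ∃ i : ℕ, d = Finsupp.single i (r : ℕ) then 1 else 0

/-- The (injective) map sending a symmetric function, written as a polynomial in the power sums,
to the corresponding formal power series in the variables `x₀, x₁, x₂, …`. -/
def toSeries : Sym ℚ →ₐ[ℚ] MvPowerSeries ℕ ℚ :=
  MvPolynomial.aeval powerSumSeries

/-- The weight of a tableau: the number of occurrences of each letter. -/
def weight {μ : YoungDiagram} (T : SemistandardYoungTableau μ) : ℕ →₀ ℕ :=
  ∑ c ∈ μ.cells, Finsupp.single (T c.1 c.2) 1

/-- The generating series `∑_T x^{weight(T)}` over all semistandard Young tableaux of shape `μ`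
(there are finitely many of each weight). -/
def schurSeries (μ : YoungDiagram) : MvPowerSeries ℕ ℚ :=
  fun d => (Nat.card {T : SemistandardYoungTableau μ // weight T = d} : ℚ)

open Classical in
/-- The Schur function `s_μ`: the unique element of `ℚ[p₁, p₂, …]` whose power series is
`∑_T x^{weight(T)}`, `T` semistandard of shape `μ`. It exists because that series is symmetric
and the power sums generate the symmetric functions over `ℚ`. -/
def schurRat (μ : YoungDiagram) : Sym ℚ :=
  if h : ∃ f : Sym ℚ, toSeries f = schurSeries μ then h.choose else 0

/-- The Schur function `s_μ` in `Λ_K`. -/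
def schur (K : Type*) [CommRing K] [Algebra ℚ K] (μ : YoungDiagram) : Sym K :=
  baseChange K (schurRat μ)

/-! ### Partitions, identified with their Young diagrams -/

theorem finite_setOf_card_eq (n : ℕ) : {μ : YoungDiagram | μ.card = n}.Finite := by
  refine Set.Finite.of_finite_image (f := YoungDiagram.cells) ?_
    (fun μ _ ν _ h => YoungDiagram.ext h)
  refine (Finset.finite_toSet (Finset.range n ×ˢ Finset.range n).powerset).subset ?_
  rintro _ ⟨μ, hμ, rfl⟩
  simp only [Finset.coe_powerset, Set.mem_preimage, Set.mem_powerset_iff, Finset.coe_subset]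
  rintro ⟨i, j⟩ hc
  have hsub : Finset.range (i + 1) ×ˢ Finset.range (j + 1) ⊆ μ.cells := by
    rintro ⟨a, b⟩ hab
    simp only [Finset.mem_product, Finset.mem_range] at hab
    exact μ.up_left_mem (by omega) (by omega) hc
  have hle := Finset.card_le_card hsub
  have hn : μ.cells.card = n := hμ
  simp only [Finset.card_product, Finset.card_range, hn] at hle
  simp only [Finset.mem_product, Finset.mem_range]
  constructor <;> nlinarith

/-- The finite set of all partitions of `n`. -/
def partitions (n : ℕ) : Finset YoungDiagram := (finite_setOf_card_eq n).toFinset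

theorem mem_partitions {n : ℕ} {μ : YoungDiagram} : μ ∈ partitions n ↔ μ.card = n := by
  simp [partitions]

theorem sortedGE_pair {a b : ℕ} (h : b ≤ a) : [a, b].SortedGE := by
  simp [List.sortedGE_iff_pairwise, h]

/-- The partition `(a, b)`, for `a ≥ b`. -/
def twoRows (a b : ℕ) (h : b ≤ a) : YoungDiagram := YoungDiagram.ofRowLens [a, b] (sortedGE_pair h)

/-- The partition `(1, 1)`. -/
def oneOne : YoungDiagram := twoRows 1 1 le_rfl

/-- The partition `(2)`. -/
def two : YoungDiagram := YoungDiagram.ofRowLens [2] (by simp [List.sortedGE_iff_pairwise])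

/-- A partition is even if all its columns have even length. -/
def IsEven (μ : YoungDiagram) : Prop := ∀ j, Even (μ.colLen j)

/-- All columns have even length, except two columns of distinct odd lengths. -/
def HasTwoDistinctOddColumns (μ : YoungDiagram) : Prop :=
  ∃ i j, Odd (μ.colLen i) ∧ Odd (μ.colLen j) ∧ μ.colLen i ≠ μ.colLen j ∧
    ∀ k, k ≠ i → k ≠ j → Even (μ.colLen k)

/-- The number of corners: cells `(r, c)` such that `(r + 1, c)` and `(r, c + 1)` are not cells. -/
def numCorners (μ : YoungDiagram) : ℕ :=
  (μ.cells.filter fun c => (c.1 + 1, c.2) ∉ μ ∧ (c.1, c.2 + 1) ∉ μ).card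

end SymmFn

end

/-! Since s_{(h-1,1)} = h_{h-1} h_1 - h_h and f ↦ f[g] is a ring homomorphism, the first plethysm is
h_{h-1}[e_2] e_2 - h_h[e_2]. Littlewood's identity writes h_k[e_2] as the sum of s_ν over ν ⊢ 2k
with even columns, and by Pieri multiplication by e_2 adds vertical strips of two cells. So the
coefficient of s_μ in the product is the number of even ν for which μ/ν is such a strip
(`card_even_removals`). If both cells lie in one column, then μ is even and that column ends in a
corner: b_μ choices. If they lie in two columns, these are the two odd columns of μ, the strip
condition makes their lengths distinct, and ν is recovered by shortening both. Subtracting h_h[e_2]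
lowers b_ν to b_ν - 1. For h_2 the shapes have even rows and the strips are horizontal, which is the
conjugate count.

Pieri and Littlewood are proved in finitely many variables, by induction on their number.
`schurPoly` obeys the branching rule: the last variable peels off a horizontal strip. Collecting
terms by the shape that remains reduces each identity to an equality between a number of shapes
above and a number of shapes below: `card_common_strips` for Pieri, `card_evenCols_strips` and
`card_evenRows_strips` for Littlewood. These are reflection bijections; the first and the third are
cases of `card_interlacing`.

The passage to Λ rests on the algebraic independence of the power sums (`toSeries_injective`), on
truncation (`coeff_toSeries`), on the branching rule for tableaux (`coeff_schurPoly`), and on the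
existence of Schur functions (`exists_evalVars_eq_schurPoly`). Everything is rational, so a general
K follows by base change. -/

noncomputable section

namespace SymmFn

/-! ### Young diagrams through their row lengths -/

theorem diagram_ext_rowLen {μ ν : YoungDiagram} (h : ∀ i, μ.rowLen i = ν.rowLen i) : μ = ν := by
  apply YoungDiagram.ext
  ext ⟨i, j⟩
  simp only [YoungDiagram.mem_cells, YoungDiagram.mem_iff_lt_rowLen, h]

theorem le_iff_rowLen {μ ν : YoungDiagram} : μ ≤ ν ↔ ∀ i, μ.rowLen i ≤ ν.rowLen i := by
  constructor
  · intro h i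
    by_contra! hlt
    have h1 : (i, ν.rowLen i) ∈ μ := YoungDiagram.mem_iff_lt_rowLen.2 hlt
    exact absurd (YoungDiagram.mem_iff_lt_rowLen.1 (h h1)) (lt_irrefl _)
  · rintro h ⟨i, j⟩ hc
    exact YoungDiagram.mem_iff_lt_rowLen.2 ((YoungDiagram.mem_iff_lt_rowLen.1 hc).trans_le (h i))

theorem exists_rowLen_eq (f : ℕ → ℕ) (hf : ∀ i, f (i + 1) ≤ f i) {n : ℕ} (h0 : f n = 0) :
    ∃ μ : YoungDiagram, ∀ i, μ.rowLen i = f i := by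
  have hanti : Antitone f := antitone_nat_of_succ_le hf
  let μ : YoungDiagram :=
    { cells := (Finset.range n ×ˢ Finset.range (f 0)).filter fun c => c.2 < f c.1
      isLowerSet := by
        rintro ⟨a, b⟩ ⟨c, d⟩ ⟨hca, hdb⟩ hab
        simp only [Finset.coe_filter, Finset.mem_product, Finset.mem_range, Set.mem_ofPred_eq]
          at hab hca hdb ⊢
        have := hanti hca
        omega }
  refine ⟨μ, fun i => ?_⟩
  have key : ∀ j, j < μ.rowLen i ↔ j < f i := by
    intro j
    rw [← YoungDiagram.mem_iff_lt_rowLen]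
    change (i, j) ∈ Finset.filter _ _ ↔ _
    simp only [Finset.mem_filter, Finset.mem_product, Finset.mem_range]
    refine ⟨fun h => h.2, fun h => ⟨⟨?_, h.trans_le (hanti (Nat.zero_le i))⟩, h⟩⟩
    by_contra! hni
    have := hanti hni
    omega
  exact le_antisymm (not_lt.1 fun h => lt_irrefl _ ((key _).1 h))
    (not_lt.1 fun h => lt_irrefl _ ((key _).2 h))

theorem rowLen_eq_zero_of_le {μ : YoungDiagram} {m n : ℕ} (hm : μ.rowLen m = 0) (h : m ≤ n) :
    μ.rowLen n = 0 :=
  Nat.le_zero.1 (hm ▸ μ.rowLen_anti m n h)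

theorem card_eq_sum_rowLen {μ : YoungDiagram} {n : ℕ} (hn : μ.rowLen n = 0) :
    μ.card = ∑ i ∈ Finset.range n, μ.rowLen i := by
  have h1 : ∀ c ∈ μ.cells, c.1 ∈ Finset.range n := by
    rintro ⟨i, j⟩ hc
    have hj := YoungDiagram.mem_iff_lt_rowLen.1 hc
    rw [Finset.mem_range]
    by_contra! hle
    rw [rowLen_eq_zero_of_le hn hle] at hj
    omega
  rw [YoungDiagram.card, Finset.card_eq_sum_card_fiberwise h1]
  exact Finset.sum_congr rfl fun i _ => (YoungDiagram.rowLen_eq_card μ).symm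

theorem rowLen_card (μ : YoungDiagram) : μ.rowLen μ.card = 0 := by
  by_contra h
  have h1 : ∀ i ∈ Finset.range (μ.card + 1), (i, 0) ∈ μ.cells := by
    intro i hi
    refine μ.up_left_mem (Nat.lt_succ_iff.1 (Finset.mem_range.1 hi)) le_rfl
      (YoungDiagram.mem_iff_lt_rowLen.2 (Nat.pos_of_ne_zero h))
  have h2 := Finset.card_le_card_of_injOn (fun i => (i, 0)) h1
    (fun a _ b _ hab => (Prod.mk.inj hab).1)
  rw [Finset.card_range] at h2
  exact absurd h2 (by simp [YoungDiagram.card])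

theorem rowLen_eq_zero_of_card_le {μ : YoungDiagram} {n : ℕ} (h : μ.card ≤ n) : μ.rowLen n = 0 :=
  rowLen_eq_zero_of_le (rowLen_card μ) h

theorem card_transpose (μ : YoungDiagram) : μ.transpose.card = μ.card := by
  have h1 : ∀ ν : YoungDiagram, ν.transpose.card ≤ ν.card := by
    intro ν
    refine Finset.card_le_card_of_injOn Prod.swap ?_ (fun a _ b _ h => Prod.swap_injective h)
    intro c hc
    exact YoungDiagram.mem_transpose.1 hc
  refine le_antisymm (h1 μ) ?_
  simpa using h1 μ.transpose

theorem card_mono {μ ν : YoungDiagram} (h : μ ≤ ν) : μ.card ≤ ν.card :=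
  Finset.card_le_card h

theorem eq_of_le_of_card_le {μ ν : YoungDiagram} (h : μ ≤ ν) (hc : ν.card ≤ μ.card) : μ = ν :=
  YoungDiagram.ext (Finset.eq_of_subset_of_card_le h hc)

theorem card_eq_zero_iff {μ : YoungDiagram} : μ.card = 0 ↔ μ = ⊥ := by
  constructor
  · intro h
    exact YoungDiagram.ext (Finset.card_eq_zero.1 h)
  · rintro rfl
    rfl

theorem rowLen_bot (i : ℕ) : (⊥ : YoungDiagram).rowLen i = 0 :=
  Nat.le_zero.1 (not_lt.1 fun h => YoungDiagram.notMem_bot (i, 0) (YoungDiagram.mem_iff_lt_rowLen.2 h))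

/-! ### Horizontal strips -/

/-- `λ / κ` is a horizontal strip. -/
def HStrip (κ l : YoungDiagram) : Prop := κ ≤ l ∧ ∀ i j, (i + 1, j) ∈ l → (i, j) ∈ κ

theorem hStrip_iff_rowLen {κ l : YoungDiagram} :
    HStrip κ l ↔ ∀ i, l.rowLen (i + 1) ≤ κ.rowLen i ∧ κ.rowLen i ≤ l.rowLen i := by
  simp only [HStrip, le_iff_rowLen, YoungDiagram.mem_iff_lt_rowLen]
  constructor
  · rintro ⟨h1, h2⟩ i
    refine ⟨?_, h1 i⟩
    by_contra! h
    exact lt_irrefl _ (h2 i _ h)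
  · exact fun h => ⟨fun i => (h i).2, fun i j hj => hj.trans_le (h i).1⟩

theorem hStrip_iff_colLen {κ l : YoungDiagram} :
    HStrip κ l ↔ ∀ j, κ.colLen j ≤ l.colLen j ∧ l.colLen j ≤ κ.colLen j + 1 := by
  have hle : κ ≤ l ↔ ∀ j, κ.colLen j ≤ l.colLen j := by
    rw [← YoungDiagram.transpose_le_iff, le_iff_rowLen]
    simp only [YoungDiagram.rowLen_transpose]
  simp only [HStrip, hle, YoungDiagram.mem_iff_lt_colLen]
  constructor
  · rintro ⟨h1, h2⟩ j
    refine ⟨h1 j, ?_⟩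
    by_contra! h
    exact lt_irrefl _ (h2 _ j h)
  · exact fun h => ⟨fun i => (h i).1, fun i j hj => by have := (h j).2; omega⟩

theorem HStrip.le {κ l : YoungDiagram} (h : HStrip κ l) : κ ≤ l := h.1

theorem HStrip.card_le {κ l : YoungDiagram} (h : HStrip κ l) : κ.card ≤ l.card := card_mono h.1

theorem finite_setOf_card_le (n : ℕ) : {μ : YoungDiagram | μ.card ≤ n}.Finite := by
  have : {μ : YoungDiagram | μ.card ≤ n} = ⋃ k ∈ Finset.range (n + 1), {μ | μ.card = k} := by
    ext μ
    simp
  rw [this]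
  exact Set.Finite.biUnion (Finset.finite_toSet _) fun k _ => finite_setOf_card_eq k

/-- All partitions of numbers up to `n`. -/
def partitionsLE (n : ℕ) : Finset YoungDiagram := (finite_setOf_card_le n).toFinset

theorem mem_partitionsLE {n : ℕ} {μ : YoungDiagram} : μ ∈ partitionsLE n ↔ μ.card ≤ n := by
  simp [partitionsLE]

open Classical in
/-- The partitions `κ` such that `μ / κ` is a horizontal strip. -/
def stripsBelow (μ : YoungDiagram) : Finset YoungDiagram :=
  (partitionsLE μ.card).filter fun κ => HStrip κ μ

theorem mem_stripsBelow {κ μ : YoungDiagram} : κ ∈ stripsBelow μ ↔ HStrip κ μ := by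
  simp only [stripsBelow, Finset.mem_filter, mem_partitionsLE, and_iff_right_iff_imp]
  exact HStrip.card_le

open Classical in
/-- The partitions `l` such that `l / μ` is a horizontal strip with `k` cells. -/
def stripsAbove (μ : YoungDiagram) (k : ℕ) : Finset YoungDiagram :=
  (partitions (μ.card + k)).filter fun l => HStrip μ l

theorem mem_stripsAbove {μ l : YoungDiagram} {k : ℕ} :
    l ∈ stripsAbove μ k ↔ l.card = μ.card + k ∧ HStrip μ l := by
  simp only [stripsAbove, Finset.mem_filter, mem_partitions]

/-! ### Counting interlacing partitions -/

/-- If `B i ≤ A i` for all `i`, the partitions `l` of `N` with `A i ≤ l i` and `l (i + 1) ≤ B i`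
are as many as the partitions `κ` with `A (i + 1) ≤ κ i ≤ B i` and `|κ| ≥ |A| + |B| - N`. -/
theorem card_interlacing {A B : ℕ → ℕ} {n : ℕ} (hBA : ∀ i, B i ≤ A i) (hA : ∀ i, n ≤ i → A i = 0)
    (N : ℕ) (s t : Finset YoungDiagram)
    (hs : ∀ l, l ∈ s ↔ (∀ i, A i ≤ l.rowLen i ∧ l.rowLen (i + 1) ≤ B i) ∧ l.card = N)
    (ht : ∀ κ, κ ∈ t ↔ (∀ i, A (i + 1) ≤ κ.rowLen i ∧ κ.rowLen i ≤ B i) ∧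
      ∑ i ∈ Finset.range n, A i + ∑ i ∈ Finset.range n, B i ≤ N + κ.card) :
    s.card = t.card := by
  have hB : ∀ i, n ≤ i → B i = 0 := fun i hi => Nat.le_zero.1 (hA i hi ▸ hBA i)
  have hsumA : ∑ i ∈ Finset.range n, A i = A 0 + ∑ i ∈ Finset.range n, A (i + 1) := by
    have h1 := Finset.sum_range_succ' A n
    rw [Finset.sum_range_succ, hA n le_rfl] at h1
    omega
  have hl0 : ∀ l : YoungDiagram, (∀ i, A i ≤ l.rowLen i ∧ l.rowLen (i + 1) ≤ B i) →
      l.card = l.rowLen 0 + ∑ i ∈ Finset.range n, l.rowLen (i + 1) := by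
    intro l hl
    have h1 : l.rowLen (n + 1) = 0 := Nat.le_zero.1 (hB n le_rfl ▸ (hl n).2)
    rw [card_eq_sum_rowLen h1, Finset.sum_range_succ', add_comm]
  have hκ0 : ∀ κ : YoungDiagram, (∀ i, A (i + 1) ≤ κ.rowLen i ∧ κ.rowLen i ≤ B i) →
      κ.card = ∑ i ∈ Finset.range n, κ.rowLen i := by
    intro κ hκ
    exact card_eq_sum_rowLen (Nat.le_zero.1 (hB n le_rfl ▸ (hκ n).2))
  -- Row i + 1 of `l` and row i of `κ` range over the same interval from A (i + 1) to B i, and the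
  -- bijection reflects it. Row 0 of `l` is fixed by the size N, so its lower bound A 0 becomes the
  -- size condition on `κ`.
  have hdown : ∀ l ∈ s, ∃ κ : YoungDiagram, ∀ i,
      κ.rowLen i = A (i + 1) + B i - l.rowLen (i + 1) := by
    intro l hl
    have h := ((hs l).1 hl).1
    refine exists_rowLen_eq _ (fun i => ?_) (n := n) ?_
    · have := h i; have := h (i + 1); have := hBA (i + 1); have := h (i + 2)
      simp only [add_assoc, Nat.reduceAdd] at *
      omega
    · simp [hA (n + 1) (by omega), hB n le_rfl]
  have hsum : ∀ κ ∈ t, ∑ i ∈ Finset.range n, (A (i + 1) + B i - κ.rowLen i) +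
      κ.card = ∑ i ∈ Finset.range n, A (i + 1) + ∑ i ∈ Finset.range n, B i := by
    intro κ hκ
    have h := ((ht κ).1 hκ).1
    rw [hκ0 κ h, ← Finset.sum_add_distrib, ← Finset.sum_add_distrib]
    exact Finset.sum_congr rfl fun i _ => by have := h i; omega
  have hup : ∀ κ ∈ t, ∃ l : YoungDiagram,
      l.rowLen 0 = N - ∑ i ∈ Finset.range n, (A (i + 1) + B i - κ.rowLen i) ∧
      ∀ i, l.rowLen (i + 1) = A (i + 1) + B i - κ.rowLen i := by
    intro κ hκ
    have h := ((ht κ).1 hκ).1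
    have hc := ((ht κ).1 hκ).2
    -- Row 0 is what the other rows leave of N. The size condition on `κ` keeps this difference at
    -- least A 0, so the subtraction does not truncate.
    have hex := exists_rowLen_eq (fun i => if i = 0 then
        N - ∑ i ∈ Finset.range n, (A (i + 1) + B i - κ.rowLen i)
        else A i + B (i - 1) - κ.rowLen (i - 1)) (fun i => by
      cases i with
      | zero =>
        have h1 := hsum κ hκ
        have := h 0; have := hBA 0
        simp only [zero_add, one_ne_zero, if_false, if_true, Nat.sub_self] at *
        omega
      | succ i =>
        have := h i; have := h (i + 1); have := hBA (i + 1)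
        simp only [Nat.add_eq_zero_iff, one_ne_zero, and_false, if_false, Nat.add_sub_cancel]
        omega) (n := n + 1) (by simp [hA (n + 1) (by omega), hB n le_rfl])
    obtain ⟨l, hl⟩ := hex
    exact ⟨l, hl 0, fun i => hl (i + 1)⟩
  choose! D hD using hdown
  choose! U hU0 hU using hup
  have hDt : ∀ l ∈ s, D l ∈ t := by
    intro l hl
    obtain ⟨h, hc⟩ := (hs l).1 hl
    have hint : ∀ i, A (i + 1) ≤ (D l).rowLen i ∧ (D l).rowLen i ≤ B i := by
      intro i
      rw [hD l hl i]
      have := h i; have := h (i + 1)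
      omega
    refine (ht _).2 ⟨hint, ?_⟩
    rw [hκ0 _ hint, ← hc, hl0 l h, hsumA]
    have h1 : ∑ i ∈ Finset.range n, l.rowLen (i + 1) +
        ∑ i ∈ Finset.range n, (D l).rowLen i =
        ∑ i ∈ Finset.range n, A (i + 1) + ∑ i ∈ Finset.range n, B i := by
      rw [← Finset.sum_add_distrib, ← Finset.sum_add_distrib]
      refine Finset.sum_congr rfl fun i _ => ?_
      rw [hD l hl i]
      have := h i
      omega
    have := (h 0).1
    omega
  have hUs : ∀ κ ∈ t, U κ ∈ s := by
    intro κ hκ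
    obtain ⟨h, hc⟩ := (ht κ).1 hκ
    have h1 := hsum κ hκ
    refine (hs _).2 ?_
    rw [and_iff_left_of_imp]
    · intro i
      rw [hU κ hκ i]
      have := h i
      cases i with
      | zero => rw [hU0 κ hκ]; omega
      | succ i => rw [hU κ hκ i]; have := h i; omega
    · intro hint
      rw [hl0 _ hint, hU0 κ hκ]
      simp only [hU κ hκ]
      omega
  refine Finset.card_nbij' D U hDt hUs (fun l hl => ?_) (fun κ hκ => ?_)
  · obtain ⟨h, hc⟩ := (hs l).1 hl
    have h2 : ∀ i, A (i + 1) + B i - (A (i + 1) + B i - l.rowLen (i + 1)) = l.rowLen (i + 1) := by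
      intro i
      have := h i; omega
    refine diagram_ext_rowLen fun i => ?_
    cases i with
    | zero =>
      rw [hU0 _ (hDt l hl), ← hc, hl0 l h]
      simp [hD l hl, h2]
    | succ i => rw [hU _ (hDt l hl), hD l hl, h2]
  · have h := ((ht κ).1 hκ).1
    refine diagram_ext_rowLen fun i => ?_
    rw [hD _ (hUs κ hκ), hU κ hκ]
    have := h i
    omega

theorem sum_max_add_sum_min (μ ν : YoungDiagram) {n : ℕ} (hμ : μ.rowLen n = 0)
    (hν : ν.rowLen n = 0) :
    ∑ i ∈ Finset.range n, max (μ.rowLen i) (ν.rowLen i) +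
      ∑ i ∈ Finset.range n, min (μ.rowLen i) (ν.rowLen i) = μ.card + ν.card := by
  rw [card_eq_sum_rowLen hμ, card_eq_sum_rowLen hν, ← Finset.sum_add_distrib,
    ← Finset.sum_add_distrib]
  exact Finset.sum_congr rfl fun i _ => max_add_min _ _

open Classical in
/-- The local growth rule behind Pieri's formula. -/
theorem card_common_strips (μ ν : YoungDiagram) (N : ℕ) :
    ((partitions N).filter fun l => HStrip μ l ∧ HStrip ν l).card =
      ((stripsBelow μ).filter fun κ => HStrip κ ν ∧ μ.card + ν.card ≤ N + κ.card).card := by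
  have hμ : μ.rowLen (μ.card + ν.card) = 0 := rowLen_eq_zero_of_card_le (by omega)
  have hν : ν.rowLen (μ.card + ν.card) = 0 := rowLen_eq_zero_of_card_le (by omega)
  -- Two interlacing conditions merge into one with bounds max and min, and max + min restores |μ| +
  -- |ν| in the size condition.
  refine card_interlacing (A := fun i => max (μ.rowLen i) (ν.rowLen i))
    (B := fun i => min (μ.rowLen i) (ν.rowLen i)) (n := μ.card + ν.card)
    (fun i => min_le_max) (fun i hi => ?_) N _ _ (fun l => ?_) (fun κ => ?_)
  · rw [rowLen_eq_zero_of_le hμ hi, rowLen_eq_zero_of_le hν hi, max_self]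
  · simp only [Finset.mem_filter, mem_partitions, hStrip_iff_rowLen, max_le_iff, le_min_iff]
    rw [and_comm, ← forall_and]
    refine and_congr_left' (forall_congr' fun i => ?_)
    tauto
  · rw [sum_max_add_sum_min μ ν hμ hν]
    simp only [Finset.mem_filter, mem_stripsBelow, hStrip_iff_rowLen, max_le_iff, le_min_iff]
    rw [← and_assoc, ← forall_and]
    refine and_congr_left' (forall_congr' fun i => ?_)
    tauto

/-- All rows have even length. -/
def EvenRows (μ : YoungDiagram) : Prop := ∀ i, Even (μ.rowLen i)

/-! ### Column lengths, and strips bounded by shapes with even rows or even columns -/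

theorem exists_colLen_eq (f : ℕ → ℕ) (hf : ∀ i, f (i + 1) ≤ f i) {n : ℕ} (h0 : f n = 0) :
    ∃ μ : YoungDiagram, ∀ i, μ.colLen i = f i := by
  obtain ⟨μ, hμ⟩ := exists_rowLen_eq f hf h0
  exact ⟨μ.transpose, fun i => by rw [YoungDiagram.colLen_transpose, hμ]⟩

theorem diagram_ext_colLen {μ ν : YoungDiagram} (h : ∀ i, μ.colLen i = ν.colLen i) : μ = ν := by
  rw [← YoungDiagram.transpose_eq_iff]
  exact diagram_ext_rowLen fun i => by simp only [YoungDiagram.rowLen_transpose, h]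

theorem colLen_eq_zero_of_card_le {μ : YoungDiagram} {n : ℕ} (h : μ.card ≤ n) :
    μ.colLen n = 0 := by
  rw [← YoungDiagram.rowLen_transpose]
  exact rowLen_eq_zero_of_card_le (by rwa [card_transpose])

theorem card_eq_sum_colLen {μ : YoungDiagram} {n : ℕ} (hn : μ.colLen n = 0) :
    μ.card = ∑ i ∈ Finset.range n, μ.colLen i := by
  rw [← YoungDiagram.rowLen_transpose] at hn
  rw [← card_transpose, card_eq_sum_rowLen hn]
  simp only [YoungDiagram.rowLen_transpose]

theorem exists_double (μ : YoungDiagram) :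
    ∃ ν : YoungDiagram, ∀ i, ν.rowLen i = 2 * μ.rowLen i :=
  exists_rowLen_eq _ (fun i => Nat.mul_le_mul_left 2 (μ.rowLen_anti i (i + 1) (Nat.le_succ i)))
    (n := μ.card) (by rw [rowLen_card])

/-- The diagram with all rows of `μ` doubled. -/
def doubleRows (μ : YoungDiagram) : YoungDiagram := (exists_double μ).choose

theorem rowLen_doubleRows (μ : YoungDiagram) (i : ℕ) :
    (doubleRows μ).rowLen i = 2 * μ.rowLen i := (exists_double μ).choose_spec i

theorem doubleRows_injective : Function.Injective doubleRows := by
  intro μ ν h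
  refine diagram_ext_rowLen fun i => ?_
  have := rowLen_doubleRows μ i
  rw [h, rowLen_doubleRows] at this
  omega

theorem card_doubleRows (μ : YoungDiagram) : (doubleRows μ).card = 2 * μ.card := by
  have h := rowLen_card μ
  rw [card_eq_sum_rowLen (μ := doubleRows μ) (n := μ.card)
    (by rw [rowLen_doubleRows, h])]
  simp only [rowLen_doubleRows]
  rw [← Finset.mul_sum, ← card_eq_sum_rowLen h]

theorem evenRows_doubleRows (μ : YoungDiagram) : EvenRows (doubleRows μ) := fun i => by
  rw [rowLen_doubleRows]
  exact even_two_mul _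

theorem EvenRows.exists_doubleRows {ν : YoungDiagram} (h : EvenRows ν) :
    ∃ μ, doubleRows μ = ν := by
  obtain ⟨μ, hμ⟩ := exists_rowLen_eq (fun i => ν.rowLen i / 2)
    (fun i => Nat.div_le_div_right (ν.rowLen_anti i (i + 1) (Nat.le_succ i)))
    (n := ν.card) (by rw [rowLen_card])
  refine ⟨μ, diagram_ext_rowLen fun i => ?_⟩
  rw [rowLen_doubleRows, hμ, Nat.mul_div_cancel' (h i).two_dvd]

open Classical in
-- Halving the rows of ν turns interlacing with κ into interlacing with the bounds ⌈κ_i/2⌉ and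
-- ⌊κ_i/2⌋, whose sum is κ_i, so `card_interlacing` applies. The slack in the inequality will
-- account for the powers of x_n² coming from h_2.
theorem card_evenRows_strips (κ : YoungDiagram) (k : ℕ) :
    ((partitions (2 * k)).filter fun ν => EvenRows ν ∧ HStrip κ ν).card =
      ((stripsBelow κ).filter fun ν => EvenRows ν ∧ 2 * κ.card ≤ 2 * k + ν.card).card := by
  have h1 : ((partitions (2 * k)).filter fun ν => EvenRows ν ∧ HStrip κ ν) =
      ((partitions k).filter fun l => HStrip κ (doubleRows l)).image doubleRows := by
    ext ν
    simp only [Finset.mem_filter, Finset.mem_image, mem_partitions]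
    constructor
    · rintro ⟨hc, he, hs⟩
      obtain ⟨l, rfl⟩ := he.exists_doubleRows
      rw [card_doubleRows] at hc
      exact ⟨l, ⟨by omega, hs⟩, rfl⟩
    · rintro ⟨l, ⟨hc, hs⟩, rfl⟩
      exact ⟨by rw [card_doubleRows, hc], evenRows_doubleRows l, hs⟩
  have h2 : ((stripsBelow κ).filter fun ν => EvenRows ν ∧ 2 * κ.card ≤ 2 * k + ν.card) =
      ((partitionsLE κ.card).filter fun m => HStrip (doubleRows m) κ ∧
        κ.card ≤ k + m.card).image doubleRows := by
    ext ν
    simp only [Finset.mem_filter, Finset.mem_image, mem_partitionsLE, mem_stripsBelow]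
    constructor
    · rintro ⟨hs, he, hc⟩
      obtain ⟨l, rfl⟩ := he.exists_doubleRows
      have := hs.card_le
      rw [card_doubleRows] at hc this
      exact ⟨l, ⟨by omega, hs, by omega⟩, rfl⟩
    · rintro ⟨l, ⟨-, hs, hc⟩, rfl⟩
      exact ⟨hs, evenRows_doubleRows l, by rw [card_doubleRows]; omega⟩
  rw [h1, h2, Finset.card_image_of_injective _ doubleRows_injective,
    Finset.card_image_of_injective _ doubleRows_injective]
  have hsum : ∑ i ∈ Finset.range κ.card, (κ.rowLen i + 1) / 2 +
      ∑ i ∈ Finset.range κ.card, κ.rowLen i / 2 = κ.card := by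
    rw [← Finset.sum_add_distrib]
    refine Eq.trans ?_ (card_eq_sum_rowLen (rowLen_card κ)).symm
    exact Finset.sum_congr rfl fun i _ => by omega
  refine card_interlacing (A := fun i => (κ.rowLen i + 1) / 2)
    (B := fun i => κ.rowLen i / 2) (n := κ.card)
    (fun i => by omega) (fun i hi => ?_) k _ _ (fun l => ?_) (fun m => ?_)
  · simp only [rowLen_eq_zero_of_card_le hi, Nat.reduceAdd, Nat.reduceDiv]
  · simp only [Finset.mem_filter, mem_partitions, hStrip_iff_rowLen, rowLen_doubleRows]
    rw [and_comm]
    refine and_congr_left' (forall_congr' fun i => ?_)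
    omega
  · rw [hsum]
    simp only [Finset.mem_filter, mem_partitionsLE, hStrip_iff_rowLen, rowLen_doubleRows]
    have h3 : (∀ i, κ.rowLen (i + 1) ≤ 2 * m.rowLen i ∧ 2 * m.rowLen i ≤ κ.rowLen i) ↔
        ∀ i, (κ.rowLen (i + 1) + 1) / 2 ≤ m.rowLen i ∧ m.rowLen i ≤ κ.rowLen i / 2 :=
      forall_congr' fun i => by omega
    rw [h3, and_iff_right_of_imp]
    rintro ⟨h4, -⟩
    refine card_mono (le_iff_rowLen.2 fun i => ?_)
    have := h4 i
    omega

open Classical in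
-- Parity leaves no choice: column j of ν is that of κ rounded to an even number, up for a strip
-- above and down for a strip below. Reflection of column lengths in those of κ exchanges the two
-- roundings and gives the size relation.
theorem card_evenCols_strips (κ : YoungDiagram) (k : ℕ) :
    ((partitions (2 * k)).filter fun ν => IsEven ν ∧ HStrip κ ν).card =
      ((stripsBelow κ).filter fun ν => IsEven ν ∧ 2 * κ.card = 2 * k + ν.card).card := by
  -- Strips above and below κ are treated together, so that one map `R` is its own inverse. The side
  -- must be the same for all columns: otherwise the reflected lengths need not decrease.
  let Near : YoungDiagram → Prop := fun ν =>
    (∀ j, κ.colLen j ≤ ν.colLen j ∧ ν.colLen j ≤ κ.colLen j + 1) ∨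
      ∀ j, ν.colLen j ≤ κ.colLen j ∧ κ.colLen j ≤ ν.colLen j + 1
  have hnd : ∀ ν, Near ν → ∀ j, ν.colLen j ≤ κ.colLen j + 1 ∧ κ.colLen j ≤ ν.colLen j + 1 := by
    rintro ν (h | h) j <;> have := h j <;> omega
  have hrefl : ∀ ν : YoungDiagram, IsEven ν → Near ν →
      ∃ ρ : YoungDiagram, ∀ j, ρ.colLen j = 2 * κ.colLen j - ν.colLen j := by
    intro ν he hd
    refine exists_colLen_eq _ (fun j => ?_) (n := κ.card) ?_
    · obtain ⟨a, ha⟩ := he j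
      obtain ⟨b, hb⟩ := he (j + 1)
      have h3 := κ.colLen_anti j (j + 1) (Nat.le_succ j)
      have h4 := ν.colLen_anti j (j + 1) (Nat.le_succ j)
      rcases hd with hd | hd <;> have h1 := hd j <;> have h2 := hd (j + 1) <;> omega
    · rw [colLen_eq_zero_of_card_le le_rfl]
      omega
  have hle : ∀ ν : YoungDiagram, IsEven ν → Near ν → ∀ j, ν.colLen j ≤ 2 * κ.colLen j := by
    intro ν he hd j
    have h1 := hnd ν hd j
    obtain ⟨a, ha⟩ := he j
    omega
  have hreflc : ∀ ν ρ : YoungDiagram, (∀ j, ν.colLen j ≤ 2 * κ.colLen j) →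
      (∀ j, ρ.colLen j = 2 * κ.colLen j - ν.colLen j) → ρ.card + ν.card = 2 * κ.card := by
    intro ν ρ h hρ
    have h0 : κ.colLen κ.card = 0 := colLen_eq_zero_of_card_le le_rfl
    have hν0 : ν.colLen κ.card = 0 := by have := h κ.card; omega
    have hρ0 : ρ.colLen κ.card = 0 := by have := hρ κ.card; omega
    rw [card_eq_sum_colLen hν0, card_eq_sum_colLen hρ0, ← Finset.sum_add_distrib]
    refine Eq.trans ?_ (congrArg (2 * ·) (card_eq_sum_colLen h0).symm)
    simp only [Finset.mul_sum]
    refine Finset.sum_congr rfl fun j _ => ?_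
    have := h j; have := hρ j
    omega
  choose! R hR using hrefl
  have hev : ∀ ν, IsEven ν → Near ν → IsEven (R ν) := by
    intro ν he hd j
    obtain ⟨a, ha⟩ := he j
    have := hle ν he hd j
    rw [hR ν he hd j]
    exact ⟨κ.colLen j - a, by omega⟩
  have hnear : ∀ ν, IsEven ν → Near ν → Near (R ν) := by
    intro ν he hd
    rcases id hd with h | h
    · right
      intro j
      have := hle ν he hd j
      have := h j
      rw [hR ν he hd j]
      omega
    · left
      intro j
      have := hle ν he hd j
      have := h j
      rw [hR ν he hd j]
      omega
  have hRR : ∀ ν, IsEven ν → Near ν → R (R ν) = ν := by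
    intro ν he hd
    refine diagram_ext_colLen fun j => ?_
    rw [hR _ (hev ν he hd) (hnear ν he hd), hR ν he hd]
    have := hle ν he hd j
    omega
  have hup : ∀ ν, HStrip κ ν → Near ν := fun ν h => Or.inl (hStrip_iff_colLen.1 h)
  have hdn : ∀ ν, HStrip ν κ → Near ν := fun ν h => Or.inr (hStrip_iff_colLen.1 h)
  refine Finset.card_nbij' R R ?_ ?_ ?_ ?_
  · intro ν hν
    simp only [Finset.mem_coe, Finset.mem_filter, mem_partitions, mem_stripsBelow] at hν ⊢
    obtain ⟨hc, he, hs⟩ := hν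
    refine ⟨hStrip_iff_colLen.2 fun j => ?_, hev ν he (hup ν hs), ?_⟩
    · have := hStrip_iff_colLen.1 hs j
      rw [hR ν he (hup ν hs)]
      omega
    · have := hreflc ν _ (hle ν he (hup ν hs)) (hR ν he (hup ν hs))
      omega
  · intro ν hν
    simp only [Finset.mem_coe, Finset.mem_filter, mem_partitions, mem_stripsBelow] at hν ⊢
    obtain ⟨hs, he, hc⟩ := hν
    refine ⟨?_, hev ν he (hdn ν hs), hStrip_iff_colLen.2 fun j => ?_⟩
    · have := hreflc ν _ (hle ν he (hdn ν hs)) (hR ν he (hdn ν hs))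
      omega
    · have := hStrip_iff_colLen.1 hs j
      rw [hR ν he (hdn ν hs)]
      omega
  · intro ν hν
    simp only [Finset.mem_coe, Finset.mem_filter, mem_partitions] at hν
    exact hRR ν hν.2.1 (hup ν hν.2.2)
  · intro ν hν
    simp only [Finset.mem_coe, Finset.mem_filter, mem_stripsBelow] at hν
    exact hRR ν hν.2.1 (hdn ν hν.1)

/-! ### Vertical strips of two cells -/

/-- `l / κ` is a vertical strip. -/
def VStrip (κ l : YoungDiagram) : Prop := HStrip κ.transpose l.transpose

theorem vStrip_iff_rowLen {κ l : YoungDiagram} :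
    VStrip κ l ↔ ∀ i, κ.rowLen i ≤ l.rowLen i ∧ l.rowLen i ≤ κ.rowLen i + 1 := by
  simp only [VStrip, hStrip_iff_colLen, YoungDiagram.colLen_transpose]

theorem vStrip_iff_colLen {κ l : YoungDiagram} :
    VStrip κ l ↔ ∀ j, l.colLen (j + 1) ≤ κ.colLen j ∧ κ.colLen j ≤ l.colLen j := by
  simp only [VStrip, hStrip_iff_rowLen, YoungDiagram.rowLen_transpose]

/-- Two natural sequences `f ≤ g` whose sums differ by two differ either by two in one place or
by one in two places. -/
theorem sum_eq_add_two {f g : ℕ → ℕ} {n : ℕ} (hfg : ∀ i, f i ≤ g i) (hn : ∀ i, n ≤ i → g i = 0)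
    (hsum : ∑ i ∈ Finset.range n, g i = ∑ i ∈ Finset.range n, f i + 2) :
    (∃ a, g a = f a + 2 ∧ ∀ i, i ≠ a → g i = f i) ∨
      ∃ a b, a < b ∧ g a = f a + 1 ∧ g b = f b + 1 ∧ ∀ i, i ≠ a → i ≠ b → g i = f i := by
  have hd : ∑ i ∈ Finset.range n, (g i - f i) = 2 := by
    have h1 : ∑ i ∈ Finset.range n, (g i - f i) + ∑ i ∈ Finset.range n, f i =
        ∑ i ∈ Finset.range n, g i := by
      rw [← Finset.sum_add_distrib]
      exact Finset.sum_congr rfl fun i _ => by have := hfg i; omega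
    omega
  have hout : ∀ i, i ∉ Finset.range n → g i = f i := by
    intro i hi
    have := hn i (by simpa using hi)
    have := hfg i
    omega
  have hpos : ∃ a ∈ Finset.range n, g a - f a ≠ 0 :=
    Finset.exists_ne_zero_of_sum_ne_zero (by rw [hd]; norm_num)
  obtain ⟨a, ha, ha0⟩ := hpos
  have h2 := Finset.add_sum_erase _ (fun i => g i - f i) ha
  simp only [hd] at h2
  by_cases h3 : g a - f a = 2
  · left
    refine ⟨a, by omega, fun i hi => ?_⟩
    by_cases hin : i ∈ Finset.range n
    · have h4 : ∑ i ∈ (Finset.range n).erase a, (g i - f i) = 0 := by omega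
      have h5 := Finset.sum_eq_zero_iff.1 h4 i (Finset.mem_erase.2 ⟨hi, hin⟩)
      have := hfg i
      omega
    · exact hout i hin
  · right
    obtain ⟨b, hb, hb0⟩ : ∃ b ∈ (Finset.range n).erase a, g b - f b ≠ 0 :=
      Finset.exists_ne_zero_of_sum_ne_zero (by omega)
    have h4 := Finset.add_sum_erase _ (fun i => g i - f i) hb
    have hba := (Finset.mem_erase.1 hb).1
    have h5 : ∑ i ∈ ((Finset.range n).erase a).erase b, (g i - f i) = 0 := by
      omega
    have hrest : ∀ i, i ≠ a → i ≠ b → g i = f i := by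
      intro i hia hib
      by_cases hin : i ∈ Finset.range n
      · have h6 := Finset.sum_eq_zero_iff.1 h5 i
          (Finset.mem_erase.2 ⟨hib, Finset.mem_erase.2 ⟨hia, hin⟩⟩)
        have := hfg i
        omega
      · exact hout i hin
    rcases lt_or_gt_of_ne hba with h | h
    · exact ⟨b, a, h, by omega, by omega, fun i h1 h2 => hrest i h2 h1⟩
    · exact ⟨a, b, h, by omega, by omega, hrest⟩

theorem sum_eq_add_one {f g : ℕ → ℕ} {n : ℕ} (hfg : ∀ i, f i ≤ g i) (hn : ∀ i, n ≤ i → g i = 0)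
    (hsum : ∑ i ∈ Finset.range n, g i = ∑ i ∈ Finset.range n, f i + 1) :
    ∃ a, g a = f a + 1 ∧ ∀ i, i ≠ a → g i = f i := by
  -- An artificial unit is placed at index n, where f and g both vanish; the other of the two units
  -- is the place sought.
  have h1 := sum_eq_add_two (f := f) (g := fun i => if i = n then 1 else g i) (n := n + 1)
    (fun i => ?_) (fun i hi => ?_) ?_
  · have hgn := hn n le_rfl
    have hfn := hfg n
    rcases h1 with ⟨a, ha, h⟩ | ⟨a, b, hab, ha, hb, h⟩
    · have h2 := h n
      simp only at ha h2
      split_ifs at ha h2 <;> omega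
    · rcases eq_or_ne a n with rfl | han
      · have h3 := hn b hab.le
        simp only [hab.ne', if_false] at hb
        omega
      · have hbn : b = n := by
          by_contra hbn
          have h2 := h n (Ne.symm han) (Ne.symm hbn)
          simp only [if_true] at h2
          omega
        subst hbn
        simp only [han, if_false] at ha
        refine ⟨a, ha, fun i hi => ?_⟩
        rcases eq_or_ne i b with rfl | hib
        · omega
        · have h2 := h i hi hib
          simpa only [hib, if_false] using h2
  · split_ifs with h
    · subst h
      have := hn i le_rfl; have := hfg i
      omega
    · exact hfg i
  · have := hn i (by omega)
    rw [if_neg (by omega), this]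
  · have h2 : ∑ i ∈ Finset.range n, (if i = n then 1 else g i) = ∑ i ∈ Finset.range n, g i :=
      Finset.sum_congr rfl fun i hi => if_neg (Finset.mem_range.1 hi).ne
    have := hn n le_rfl; have := hfg n
    rw [Finset.sum_range_succ, Finset.sum_range_succ, h2, if_pos rfl]
    omega

theorem rowLen_sum_of_card {μ ν : YoungDiagram} {k : ℕ} (hc : μ.card = ν.card + k) :
    ∑ i ∈ Finset.range μ.card, μ.rowLen i = ∑ i ∈ Finset.range μ.card, ν.rowLen i + k := by
  rw [← card_eq_sum_rowLen (rowLen_card μ),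
    ← card_eq_sum_rowLen (rowLen_eq_zero_of_card_le (by omega)), hc]

theorem hStrip_of_card_eq_succ {κ l : YoungDiagram} (hle : κ ≤ l) (hc : l.card = κ.card + 1) :
    HStrip κ l := by
  have hle' := le_iff_rowLen.1 hle
  obtain ⟨a, ha, h⟩ := sum_eq_add_one hle' (fun i hi => rowLen_eq_zero_of_card_le hi)
    (rowLen_sum_of_card hc)
  refine hStrip_iff_rowLen.2 fun i => ⟨?_, hle' i⟩
  by_cases hi : i + 1 = a
  · have h1 := h i (by omega)
    have := l.rowLen_anti i (i + 1) (Nat.le_succ i)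
    omega
  · rw [h _ hi]
    exact κ.rowLen_anti i (i + 1) (Nat.le_succ i)

/-- Quantifying over i with `i + 1 = a` makes the condition vacuous for the top row, where a cell
can always be added. -/
theorem exists_addCell {ν : YoungDiagram} {a : ℕ} (h : ∀ i, i + 1 = a → ν.rowLen a < ν.rowLen i) :
    ∃ κ : YoungDiagram, κ.card = ν.card + 1 ∧
      ∀ i, κ.rowLen i = ν.rowLen i + if i = a then 1 else 0 := by
  have hz : ν.rowLen (ν.card + a + 1) = 0 := rowLen_eq_zero_of_card_le (by omega)
  obtain ⟨κ, hκ⟩ := exists_rowLen_eq (fun i => ν.rowLen i + if i = a then 1 else 0)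
    (fun i => by
      have := ν.rowLen_anti i (i + 1) (Nat.le_succ i)
      by_cases hi : i + 1 = a
      · have := h i hi
        subst hi
        simp only [if_true]
        omega
      · simp only [hi, if_false]
        omega) (n := ν.card + a + 1) (by rw [hz, if_neg (by omega)])
  refine ⟨κ, ?_, hκ⟩
  have h1 := card_eq_sum_rowLen (μ := κ) (n := ν.card + a + 1)
    (by rw [hκ, hz, if_neg (by omega)])
  simp only [hκ, Finset.sum_add_distrib, Finset.sum_ite_eq', Finset.mem_range] at h1
  rw [if_pos (by omega), ← card_eq_sum_rowLen hz] at h1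
  exact h1

open Classical in
-- This is h_1² = h_2 + e_2 at the level of shapes: κ records which of the two cells is added first.
-- Cells in one row or in one column allow one order and form one kind of strip; otherwise both
-- orders occur and the strip is of both kinds.
theorem card_chains {ν μ : YoungDiagram} (hc : μ.card = ν.card + 2) :
    ((stripsAbove ν 1).filter fun κ => HStrip κ μ).card =
      (if HStrip ν μ then 1 else 0) + if VStrip ν μ then 1 else 0 := by
  have hmem : ∀ κ, κ ∈ (stripsAbove ν 1).filter (fun κ => HStrip κ μ) ↔
      κ.card = ν.card + 1 ∧ ν ≤ κ ∧ κ ≤ μ := by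
    intro κ
    rw [Finset.mem_filter, mem_stripsAbove]
    constructor
    · rintro ⟨⟨h1, h2⟩, h3⟩
      exact ⟨h1, h2.le, h3.le⟩
    · rintro ⟨h1, h2, h3⟩
      exact ⟨⟨h1, hStrip_of_card_eq_succ h2 h1⟩, hStrip_of_card_eq_succ h3 (by omega)⟩
  by_cases hle : ν ≤ μ
  swap
  · have h1 : ¬ HStrip ν μ := fun h => hle h.le
    have h2 : ¬ VStrip ν μ := fun h => hle (YoungDiagram.transpose_le_iff.1 h.le)
    rw [if_neg h1, if_neg h2, Finset.card_eq_zero, Finset.eq_empty_iff_forall_notMem]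
    intro κ hκ
    obtain ⟨-, h3, h4⟩ := (hmem κ).1 hκ
    exact hle (h3.trans h4)
  have hle' := le_iff_rowLen.1 hle
  have hstep : ∀ κ, κ ∈ (stripsAbove ν 1).filter (fun κ => HStrip κ μ) →
      ∃ c, κ.rowLen c = ν.rowLen c + 1 ∧ (∀ i, i ≠ c → κ.rowLen i = ν.rowLen i) ∧
        ∀ i, κ.rowLen i ≤ μ.rowLen i := by
    intro κ hκ
    obtain ⟨h1, h2, h3⟩ := (hmem κ).1 hκ
    obtain ⟨c, hc1, hc2⟩ := sum_eq_add_one (le_iff_rowLen.1 h2)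
      (fun i hi => rowLen_eq_zero_of_card_le hi) (rowLen_sum_of_card h1)
    exact ⟨c, hc1, hc2, le_iff_rowLen.1 h3⟩
  rcases sum_eq_add_two hle' (fun i hi => rowLen_eq_zero_of_card_le hi)
    (rowLen_sum_of_card hc) with ⟨a, ha, h⟩ | ⟨a, b, hab, ha, hb, h⟩
  · have hadd : ∀ i, i + 1 = a → ν.rowLen a < ν.rowLen i := by
      intro i hi
      have h1 := h i (by omega)
      have := μ.rowLen_anti i a (by omega)
      omega
    have hH : HStrip ν μ := hStrip_iff_rowLen.2 fun i => ⟨by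
      by_cases hi : i + 1 = a
      · have h1 := h i (by omega)
        have := μ.rowLen_anti i (i + 1) (Nat.le_succ i)
        omega
      · rw [h _ hi]
        exact ν.rowLen_anti i (i + 1) (Nat.le_succ i), hle' i⟩
    have hV : ¬ VStrip ν μ := fun hV => by
      have := vStrip_iff_rowLen.1 hV a
      omega
    obtain ⟨κ, hκc, hκ⟩ := exists_addCell hadd
    rw [if_pos hH, if_neg hV, Finset.card_eq_one]
    refine ⟨κ, Finset.eq_singleton_iff_unique_mem.2 ⟨(hmem κ).2 ⟨hκc, ?_, ?_⟩, ?_⟩⟩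
    · exact le_iff_rowLen.2 fun i => by rw [hκ]; omega
    · refine le_iff_rowLen.2 fun i => ?_
      rw [hκ]
      split_ifs with hi
      · subst hi; omega
      · exact hle' i
    · intro ρ hρ
      obtain ⟨c, hc1, hc2, hc3⟩ := hstep ρ hρ
      have hca : c = a := by
        by_contra hca
        have := hc3 c; have := h c hca
        omega
      subst hca
      refine diagram_ext_rowLen fun i => ?_
      rw [hκ]
      split_ifs with hi
      · rw [hi, hc1]
      · exact hc2 i hi
  -- One cell in each of the rows a < b. The upper cell can always come first; the lower one can
  -- exactly when the cells are not stacked, that is, when the strip is also horizontal.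
  · have hV : VStrip ν μ := vStrip_iff_rowLen.2 fun i => ⟨hle' i, by
      by_cases h1 : i = a
      · subst h1; omega
      · by_cases h2 : i = b
        · subst h2; omega
        · rw [h i h1 h2]; omega⟩
    have hadda : ∀ i, i + 1 = a → ν.rowLen a < ν.rowLen i := by
      intro i hi
      have h1 := h i (by omega) (by omega)
      have := μ.rowLen_anti i a (by omega)
      omega
    obtain ⟨κ, hκc, hκ⟩ := exists_addCell hadda
    have hκm : κ ∈ (stripsAbove ν 1).filter (fun κ => HStrip κ μ) := by
      refine (hmem κ).2 ⟨hκc, le_iff_rowLen.2 fun i => by rw [hκ]; omega,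
        le_iff_rowLen.2 fun i => ?_⟩
      rw [hκ]
      split_ifs with hi
      · subst hi; omega
      · exact hle' i
    have hcab : ∀ ρ, ρ ∈ (stripsAbove ν 1).filter (fun κ => HStrip κ μ) → ρ = κ ∨
        (ρ.rowLen b = ν.rowLen b + 1 ∧ ∀ i, i ≠ b → ρ.rowLen i = ν.rowLen i) := by
      intro ρ hρ
      obtain ⟨c, hc1, hc2, hc3⟩ := hstep ρ hρ
      by_cases hca : c = a
      · left
        subst hca
        refine diagram_ext_rowLen fun i => ?_
        rw [hκ]
        split_ifs with hi
        · rw [hi, hc1]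
        · exact hc2 i hi
      · right
        by_cases hcb : c = b
        · subst hcb
          exact ⟨hc1, hc2⟩
        · have := hc3 c; have := h c hca hcb
          omega
    rw [if_pos hV]
    by_cases hH : HStrip ν μ
    · have haddb : ∀ i, i + 1 = b → ν.rowLen b < ν.rowLen i := by
        intro i hi
        have := (hStrip_iff_rowLen.1 hH i).1
        rw [hi] at this
        omega
      obtain ⟨ρ, hρc, hρ⟩ := exists_addCell haddb
      rw [if_pos hH, Finset.card_eq_two]
      refine ⟨κ, ρ, ?_, ?_⟩
      · intro heq
        have h1 := hκ a
        rw [heq, hρ a, if_pos rfl, if_neg hab.ne] at h1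
        omega
      · ext τ
        rw [Finset.mem_insert, Finset.mem_singleton]
        constructor
        · intro hτ
          refine (hcab τ hτ).imp_right fun h3 => diagram_ext_rowLen fun i => ?_
          rw [hρ]
          split_ifs with hi
          · rw [hi, h3.1]
          · exact h3.2 i hi
        · rintro (rfl | rfl)
          · exact hκm
          · refine (hmem τ).2 ⟨hρc, le_iff_rowLen.2 fun i => by rw [hρ]; omega,
              le_iff_rowLen.2 fun i => ?_⟩
            rw [hρ]
            split_ifs with hi
            · subst hi; omega
            · exact hle' i
    · rw [if_neg hH, zero_add, Finset.card_eq_one]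
      refine ⟨κ, Finset.eq_singleton_iff_unique_mem.2 ⟨hκm, fun ρ hρ => ?_⟩⟩
      refine (hcab ρ hρ).resolve_right fun h3 => hH (hStrip_iff_rowLen.2 fun i => ⟨?_, hle' i⟩)
      have hν := ν.rowLen_anti i (i + 1) (Nat.le_succ i)
      have hρa := ρ.rowLen_anti i (i + 1) (Nat.le_succ i)
      by_cases hib : i + 1 = b
      · have := h3.2 i (by omega)
        rw [hib] at hρa ⊢
        omega
      · by_cases hia : i + 1 = a
        · have h1 := h i (by omega) (by omega)
          have := μ.rowLen_anti i (i + 1) (Nat.le_succ i)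
          omega
        · rw [h _ hia hib]
          exact hν

/-! ### Removing a vertical strip of two cells and leaving even columns -/

theorem colLen_sum_of_card {μ ν : YoungDiagram} {k : ℕ} (hc : μ.card = ν.card + k) :
    ∑ i ∈ Finset.range μ.card, μ.colLen i = ∑ i ∈ Finset.range μ.card, ν.colLen i + k := by
  rw [← card_eq_sum_colLen (colLen_eq_zero_of_card_le le_rfl),
    ← card_eq_sum_colLen (colLen_eq_zero_of_card_le (by omega)), hc]

/-- Only the bottom cell of a column can be a corner, and it is one when the next column is shorter.
-/
theorem numCorners_eq (μ : YoungDiagram) :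
    numCorners μ =
      ((Finset.range μ.card).filter fun j => μ.colLen (j + 1) < μ.colLen j).card := by
  refine Finset.card_nbij' (fun c => c.2) (fun j => (μ.colLen j - 1, j)) ?_ ?_ ?_ ?_
  · rintro ⟨r, c⟩ h
    simp only [Finset.mem_coe, Finset.mem_filter, YoungDiagram.mem_cells,
      YoungDiagram.mem_iff_lt_colLen, Finset.mem_range] at h ⊢
    refine ⟨?_, by omega⟩
    by_contra! hle
    have := colLen_eq_zero_of_card_le hle
    omega
  · intro j h
    simp only [Finset.mem_coe, Finset.mem_filter, YoungDiagram.mem_cells,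
      YoungDiagram.mem_iff_lt_colLen, Finset.mem_range] at h ⊢
    omega
  · rintro ⟨r, c⟩ h
    simp only [Finset.mem_coe, Finset.mem_filter, YoungDiagram.mem_cells,
      YoungDiagram.mem_iff_lt_colLen] at h
    simp only [Prod.mk.injEq, and_true]
    omega
  · intro j h
    rfl

theorem even_or_two_odd_of_vStrip {μ ν : YoungDiagram} (hc : μ.card = ν.card + 2)
    (he : IsEven ν) (hv : VStrip ν μ) :
    (IsEven μ ∧ ∃ a, μ.colLen a = ν.colLen a + 2 ∧ ∀ i, i ≠ a → μ.colLen i = ν.colLen i) ∨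
      (HasTwoDistinctOddColumns μ ∧
        ∀ i, ν.colLen i = if Odd (μ.colLen i) then μ.colLen i - 1 else μ.colLen i) := by
  have hv' := vStrip_iff_colLen.1 hv
  rcases sum_eq_add_two (fun i => (hv' i).2) (fun i hi => colLen_eq_zero_of_card_le hi)
    (colLen_sum_of_card hc) with ⟨a, ha, h⟩ | ⟨a, b, hab, ha, hb, h⟩
  · refine Or.inl ⟨fun j => ?_, a, ha, h⟩
    by_cases hj : j = a
    · rw [hj, ha]
      exact (he a).add (by norm_num)
    · rw [h j hj]
      exact he j
  · right
    have hoa : Odd (μ.colLen a) := by rw [ha]; exact (he a).add_one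
    have hob : Odd (μ.colLen b) := by rw [hb]; exact (he b).add_one
    refine ⟨⟨a, b, hoa, hob, ?_, ?_⟩, ?_⟩
    -- Column b of μ is no longer than column a + 1, which the strip condition bounds by column a of
    -- ν, and that is shorter than column a of μ.
    · have h1 := (hv' a).1
      have := μ.colLen_anti (a + 1) b hab
      omega
    · intro k hka hkb
      rw [h k hka hkb]
      exact he k
    · intro i
      by_cases hia : i = a
      · rw [hia, if_pos hoa]; omega
      · by_cases hib : i = b
        · rw [hib, if_pos hob]; omega
        · rw [if_neg, h i hia hib]
          rw [h i hia hib, Nat.not_odd_iff_even]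
          exact he i

theorem exists_removeTwo {μ : YoungDiagram} {m a : ℕ} (hc : μ.card = m + 2) (he : IsEven μ)
    (ha : μ.colLen (a + 1) < μ.colLen a) :
    ∃ ν : YoungDiagram, (ν.card = m ∧ IsEven ν ∧ VStrip ν μ) ∧
      ∀ i, ν.colLen i = if i = a then μ.colLen i - 2 else μ.colLen i := by
  have hz : μ.colLen μ.card = 0 := colLen_eq_zero_of_card_le le_rfl
  -- Parity widens the strict descent to two, so the shortened column still fits.
  have h2 : μ.colLen (a + 1) + 2 ≤ μ.colLen a := by
    obtain ⟨x, hx⟩ := he a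
    obtain ⟨y, hy⟩ := he (a + 1)
    omega
  have hex := exists_colLen_eq (fun i => if i = a then μ.colLen i - 2 else μ.colLen i)
    (fun i => by
      have := μ.colLen_anti i (i + 1) (Nat.le_succ i)
      by_cases hi : i = a
      · subst hi
        simp only [if_true, Nat.succ_ne_self, if_false]
        omega
      · simp only [hi, if_false]
        split_ifs <;> omega) (n := μ.card) (by split_ifs <;> omega)
  obtain ⟨ν, hν⟩ := hex
  refine ⟨ν, ⟨?_, ?_, ?_⟩, hν⟩
  · have han : a ∈ Finset.range μ.card := by
      rw [Finset.mem_range]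
      by_contra! hle
      have := colLen_eq_zero_of_card_le hle
      omega
    have h3 := card_eq_sum_colLen (μ := ν) (n := μ.card) (by rw [hν]; split_ifs <;> omega)
    have h4 := card_eq_sum_colLen hz
    rw [← Finset.add_sum_erase _ (fun i => ν.colLen i) han] at h3
    rw [← Finset.add_sum_erase _ (fun i => μ.colLen i) han] at h4
    have h5 : ∑ i ∈ (Finset.range μ.card).erase a, ν.colLen i =
        ∑ i ∈ (Finset.range μ.card).erase a, μ.colLen i :=
      Finset.sum_congr rfl fun i hi => (hν i).trans (if_neg (Finset.ne_of_mem_erase hi))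
    rw [hν, if_pos rfl, h5] at h3
    omega
  · intro j
    rw [hν]
    split_ifs
    · obtain ⟨x, hx⟩ := he j
      exact ⟨x - 1, by omega⟩
    · exact he j
  · refine vStrip_iff_colLen.2 fun j => ?_
    have := μ.colLen_anti j (j + 1) (Nat.le_succ j)
    rw [hν]
    split_ifs with hj
    · subst hj; omega
    · omega

theorem exists_removeOdd {μ : YoungDiagram} {m : ℕ} (hc : μ.card = m + 2)
    (h : HasTwoDistinctOddColumns μ) :
    ∃ ν : YoungDiagram, ν.card = m ∧ IsEven ν ∧ VStrip ν μ := by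
  classical
  obtain ⟨a, b, hoa, hob, hne, hk⟩ := h
  have hab : a ≠ b := fun h => hne (by rw [h])
  have hz : μ.colLen μ.card = 0 := colLen_eq_zero_of_card_le le_rfl
  -- The only two odd columns have distinct lengths, so an odd column is strictly longer than its
  -- right neighbour and can lose a cell.
  have hlt : ∀ i, Odd (μ.colLen i) → μ.colLen (i + 1) ≤ μ.colLen i - 1 := by
    intro i hi
    have h1 := μ.colLen_anti i (i + 1) (Nat.le_succ i)
    have h2 : μ.colLen (i + 1) ≠ μ.colLen i := by
      intro heq
      have hi1 : Odd (μ.colLen (i + 1)) := heq ▸ hi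
      have h3 : ∀ j, Odd (μ.colLen j) → j = a ∨ j = b := by
        intro j hj
        by_contra! hcon
        exact Nat.not_even_iff_odd.2 hj (hk j hcon.1 hcon.2)
      rcases h3 i hi with rfl | rfl <;> rcases h3 _ hi1 with h4 | h4
      · omega
      · rw [h4] at heq; exact hne heq.symm
      · rw [h4] at heq; exact hne heq
      · omega
    omega
  have hex := exists_colLen_eq
    (fun i => if Odd (μ.colLen i) then μ.colLen i - 1 else μ.colLen i)
    (fun i => by
      have := μ.colLen_anti i (i + 1) (Nat.le_succ i)
      have := hlt i
      split_ifs with h1 h2 h2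
      · omega
      · omega
      · have := hlt i h2; omega
      · omega) (n := μ.card) (by simp only [hz]; split_ifs <;> omega)
  obtain ⟨ν, hν⟩ := hex
  refine ⟨ν, ?_, fun j => ?_, vStrip_iff_colLen.2 fun j => ?_⟩
  · have hrange : ∀ i, Odd (μ.colLen i) → i ∈ Finset.range μ.card := by
      intro i hi
      rw [Finset.mem_range]
      by_contra! hle
      rw [colLen_eq_zero_of_card_le hle] at hi
      exact absurd hi (by decide)
    have hb' : b ∈ (Finset.range μ.card).erase a :=
      Finset.mem_erase.2 ⟨hab.symm, hrange b hob⟩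
    have h3 := card_eq_sum_colLen (μ := ν) (n := μ.card)
      (by rw [hν, hz]; split_ifs <;> omega)
    have h4 := card_eq_sum_colLen hz
    rw [← Finset.add_sum_erase _ (fun i => ν.colLen i) (hrange a hoa),
      ← Finset.add_sum_erase _ (fun i => ν.colLen i) hb'] at h3
    rw [← Finset.add_sum_erase _ (fun i => μ.colLen i) (hrange a hoa),
      ← Finset.add_sum_erase _ (fun i => μ.colLen i) hb'] at h4
    have h5 : ∑ i ∈ ((Finset.range μ.card).erase a).erase b, ν.colLen i =
        ∑ i ∈ ((Finset.range μ.card).erase a).erase b, μ.colLen i :=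
      Finset.sum_congr rfl fun i hi => (hν i).trans
        (if_neg (Nat.not_odd_iff_even.2 (hk i (Finset.ne_of_mem_erase (Finset.mem_of_mem_erase hi))
          (Finset.ne_of_mem_erase hi))))
    rw [hν a, hν b, if_pos hoa, if_pos hob, h5] at h3
    have := hoa.pos; have := hob.pos
    omega
  · rw [hν]
    split_ifs with h
    · exact Nat.Odd.sub_odd h odd_one
    · exact Nat.not_odd_iff_even.1 h
  · have := μ.colLen_anti j (j + 1) (Nat.le_succ j)
    rw [hν]
    split_ifs with h
    · have := hlt j h; omega
    · omega

theorem not_isEven_of_hasTwoDistinctOddColumns {μ : YoungDiagram}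
    (h : HasTwoDistinctOddColumns μ) : ¬ IsEven μ := fun he => by
  obtain ⟨i, -, hi, -⟩ := h
  exact Nat.not_even_iff_odd.2 hi (he i)

open Classical in
-- The coefficient of s_μ in h_{h-1}[e_2] e_2. Two cells taken from one column leave the parities
-- unchanged, with one choice per corner; cells taken from two columns must come from the odd ones,
-- in a single way.
theorem card_even_removals {μ : YoungDiagram} {m : ℕ} (hc : μ.card = m + 2) :
    ((partitions m).filter fun ν => IsEven ν ∧ VStrip ν μ).card =
      (if HasTwoDistinctOddColumns μ then 1 else 0) + if IsEven μ then numCorners μ else 0 := by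
  by_cases he : IsEven μ
  · rw [if_pos he, if_neg fun h => not_isEven_of_hasTwoDistinctOddColumns h he, zero_add,
      numCorners_eq]
    symm
    have hex : ∀ a, a ∈ (Finset.range μ.card).filter (fun j => μ.colLen (j + 1) < μ.colLen j) →
        ∃ ν : YoungDiagram, (ν.card = m ∧ IsEven ν ∧ VStrip ν μ) ∧
          ∀ i, ν.colLen i = if i = a then μ.colLen i - 2 else μ.colLen i :=
      fun a ha => exists_removeTwo hc he (Finset.mem_filter.1 ha).2
    choose! D hD1 hD2 using hex
    refine Finset.card_bij (fun a _ => D a) ?_ ?_ ?_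
    · intro a ha
      rw [Finset.mem_filter, mem_partitions]
      exact hD1 a ha
    · intro a ha b hb hab
      by_contra hne
      have h1 := hD2 a ha a
      rw [hab, hD2 b hb a, if_pos rfl, if_neg hne] at h1
      have := (Finset.mem_filter.1 ha).2
      omega
    · intro ν hν
      rw [Finset.mem_filter, mem_partitions] at hν
      obtain ⟨hm, heν, hv⟩ := hν
      rcases even_or_two_odd_of_vStrip (by omega) heν hv with ⟨-, a, ha, h⟩ | ⟨h, -⟩
      · have haf : a ∈ (Finset.range μ.card).filter
            (fun j => μ.colLen (j + 1) < μ.colLen j) := by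
          rw [Finset.mem_filter, Finset.mem_range]
          have h1 := (vStrip_iff_colLen.1 hv a).1
          refine ⟨?_, by omega⟩
          by_contra! hle
          have := colLen_eq_zero_of_card_le hle
          omega
        refine ⟨a, haf, diagram_ext_colLen fun i => ?_⟩
        rw [hD2 a haf]
        split_ifs with hi
        · rw [hi]; omega
        · exact h i hi
      · exact absurd he (not_isEven_of_hasTwoDistinctOddColumns h)
  · rw [if_neg he, add_zero]
    split_ifs with h
    · rw [Finset.card_eq_one]
      obtain ⟨ν, hν⟩ := exists_removeOdd hc h
      refine ⟨ν, Finset.eq_singleton_iff_unique_mem.2 ⟨?_, fun ρ hρ => ?_⟩⟩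
      · rwa [Finset.mem_filter, mem_partitions]
      · rw [Finset.mem_filter, mem_partitions] at hρ
        have h1 := even_or_two_odd_of_vStrip (by omega) hν.2.1 hν.2.2
        have h2 := even_or_two_odd_of_vStrip (by omega) hρ.2.1 hρ.2.2
        have h1' := (h1.resolve_left fun h => he h.1).2
        have h2' := (h2.resolve_left fun h => he h.1).2
        exact diagram_ext_colLen fun i => by rw [h1', h2']
    · rw [Finset.card_eq_zero, Finset.eq_empty_iff_forall_notMem]
      intro ν hν
      rw [Finset.mem_filter, mem_partitions] at hν
      rcases even_or_two_odd_of_vStrip (by omega) hν.2.1 hν.2.2 with h1 | h1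
      · exact he h1.1
      · exact h h1.1

theorem evenRows_transpose {μ : YoungDiagram} : EvenRows μ.transpose ↔ IsEven μ := by
  simp only [EvenRows, IsEven, YoungDiagram.rowLen_transpose]

theorem transpose_mem_partitions {μ : YoungDiagram} {n : ℕ} :
    μ.transpose ∈ partitions n ↔ μ ∈ partitions n := by
  rw [mem_partitions, mem_partitions, card_transpose]

open Classical in
-- The count needed for h_2; conjugation reduces it to the one for e_2.
theorem card_evenRows_removals {μ : YoungDiagram} {m : ℕ} (hc : μ.card = m + 2) :
    ((partitions m).filter fun ν => EvenRows ν ∧ HStrip ν μ.transpose).card =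
      (if HasTwoDistinctOddColumns μ then 1 else 0) + if IsEven μ then numCorners μ else 0 := by
  rw [← card_even_removals hc]
  refine Finset.card_nbij' YoungDiagram.transpose YoungDiagram.transpose ?_ ?_ ?_ ?_
  · intro ν hν
    simp only [Finset.mem_coe, Finset.mem_filter, transpose_mem_partitions] at hν ⊢
    rw [← evenRows_transpose, VStrip, YoungDiagram.transpose_transpose]
    exact hν
  · intro ν hν
    simp only [Finset.mem_coe, Finset.mem_filter, transpose_mem_partitions,
      evenRows_transpose] at hν ⊢
    exact hν
  · exact fun ν _ => YoungDiagram.transpose_transpose ν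
  · exact fun ν _ => YoungDiagram.transpose_transpose ν

/-! ### Complete symmetric functions -/

/-- The complete symmetric function `h_n` as a polynomial in the power sums, defined by Newton's
identity `n h_n = ∑_{r=1}^n p_r h_{n-r}`. -/
def complete : ℕ → Sym ℚ
  | 0 => 1
  | n + 1 => MvPolynomial.C (1 / ((n : ℚ) + 1)) *
      ∑ i : Fin (n + 1), MvPolynomial.X (Nat.succPNat i) * complete (n - i)
termination_by n => n
decreasing_by omega

theorem complete_zero : complete 0 = 1 := by rw [complete]

section Newton

variable {R : Type*} [CommRing R] [Algebra ℚ R]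

theorem newton_complete (φ : Sym ℚ →ₐ[ℚ] R) (n : ℕ) :
    ((n : R) + 1) * φ (complete (n + 1)) = ∑ i ∈ Finset.range (n + 1),
      φ (MvPolynomial.X (Nat.succPNat i)) * φ (complete (n - i)) := by
  have h1 : ((n : R) + 1) * algebraMap ℚ R (1 / ((n : ℚ) + 1)) = 1 := by
    have h2 : (n : R) + 1 = algebraMap ℚ R ((n : ℚ) + 1) := by simp
    rw [h2, ← map_mul, mul_one_div_cancel (by positivity), map_one]
  rw [complete, map_mul, ← MvPolynomial.algebraMap_eq, AlgHom.commutes, ← mul_assoc, h1, one_mul,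
    map_sum, ← Fin.sum_univ_eq_sum_range
      (fun i => φ (MvPolynomial.X (Nat.succPNat i)) * φ (complete (n - i)))]
  simp only [map_mul]

/-- Newton's recursion has a unique solution because n + 1 is invertible over ℚ. The specialisations
of h_n below are found by guessing a solution. -/
theorem eq_complete_of_newton (φ : Sym ℚ →ₐ[ℚ] R) (u : ℕ → R) (h0 : u 0 = 1)
    (hu : ∀ n : ℕ, ((n : R) + 1) * u (n + 1) = ∑ i ∈ Finset.range (n + 1),
      φ (MvPolynomial.X (Nat.succPNat i)) * u (n - i)) (n : ℕ) : φ (complete n) = u n := by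
  induction n using Nat.strong_induction_on with
  | _ n ih =>
    cases n with
    | zero => rw [complete_zero, map_one, h0]
    | succ n =>
      have h1 : algebraMap ℚ R (1 / ((n : ℚ) + 1)) * ((n : R) + 1) = 1 := by
        have h2 : (n : R) + 1 = algebraMap ℚ R ((n : ℚ) + 1) := by simp
        rw [h2, ← map_mul, one_div_mul_cancel (by positivity), map_one]
      have h3 : ((n : R) + 1) * φ (complete (n + 1)) = ((n : R) + 1) * u (n + 1) := by
        rw [newton_complete, hu]
        exact Finset.sum_congr rfl fun i _ => by rw [ih (n - i) (by omega)]
      have h4 := congrArg (algebraMap ℚ R (1 / ((n : ℚ) + 1)) * ·) h3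
      simpa only [← mul_assoc, h1, one_mul] using h4

theorem complete_of_zero (φ : Sym ℚ →ₐ[ℚ] R) (hφ : ∀ r, φ (MvPolynomial.X r) = 0) (n : ℕ) :
    φ (complete n) = if n = 0 then 1 else 0 :=
  eq_complete_of_newton φ (fun n => if n = 0 then 1 else 0) (if_pos rfl)
    (fun n => by simp [hφ]) n

theorem complete_of_pow (φ : Sym ℚ →ₐ[ℚ] R) (y : R)
    (hφ : ∀ r : ℕ+, φ (MvPolynomial.X r) = y ^ (r : ℕ)) (n : ℕ) :
    φ (complete n) = y ^ n := by
  refine eq_complete_of_newton φ (fun n => y ^ n) (pow_zero y) (fun n => ?_) n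
  have h1 : ∀ i ∈ Finset.range (n + 1), φ (MvPolynomial.X (Nat.succPNat i)) * y ^ (n - i) =
      y ^ (n + 1) := by
    intro i hi
    have := Finset.mem_range.1 hi
    rw [hφ, Nat.succPNat_coe, ← pow_add]
    congr 1
    omega
  rw [Finset.sum_congr rfl h1, Finset.sum_const, Finset.card_range, nsmul_eq_mul]
  push_cast
  ring

theorem complete_of_scaled (φ ψ : Sym ℚ →ₐ[ℚ] R) (y : R)
    (hφ : ∀ r : ℕ+, φ (MvPolynomial.X r) = y ^ (r : ℕ) * ψ (MvPolynomial.X r)) (n : ℕ) :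
    φ (complete n) = y ^ n * ψ (complete n) := by
  refine eq_complete_of_newton φ (fun n => y ^ n * ψ (complete n))
    (by rw [complete_zero, map_one, pow_zero, one_mul]) (fun n => ?_) n
  rw [mul_left_comm, newton_complete, Finset.mul_sum]
  refine Finset.sum_congr rfl fun i hi => ?_
  have := Finset.mem_range.1 hi
  have h1 : y ^ (n + 1) = y ^ (i + 1) * y ^ (n - i) := by
    rw [← pow_add]
    congr 1
    omega
  rw [hφ, Nat.succPNat_coe, h1]
  simp only [Nat.succ_eq_add_one]
  ring

theorem derivative_mk_complete (φ : Sym ℚ →ₐ[ℚ] R) :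
    PowerSeries.derivative R (PowerSeries.mk fun n => φ (complete n)) =
      (PowerSeries.mk fun i => φ (MvPolynomial.X (Nat.succPNat i))) *
        PowerSeries.mk fun n => φ (complete n) := by
  ext n
  rw [PowerSeries.coeff_derivative, PowerSeries.coeff_mk, mul_comm, newton_complete,
    PowerSeries.coeff_mul, Finset.Nat.sum_antidiagonal_eq_sum_range_succ_mk]
  simp only [PowerSeries.coeff_mk]

/-- With H = ∑ h_n tⁿ and P = ∑ p_{i+1} tⁱ, Newton's identity reads H' = P H. By Leibniz the product
of two solutions solves the equation for the sum of the two P's. -/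
theorem complete_of_add (φ ψ χ : Sym ℚ →ₐ[ℚ] R)
    (hχ : ∀ r, χ (MvPolynomial.X r) = φ (MvPolynomial.X r) + ψ (MvPolynomial.X r)) (n : ℕ) :
    χ (complete n) =
      ∑ ij ∈ Finset.HasAntidiagonal.antidiagonal n, φ (complete ij.1) * ψ (complete ij.2) := by
  refine eq_complete_of_newton χ
    (fun n => ∑ ij ∈ Finset.HasAntidiagonal.antidiagonal n, φ (complete ij.1) * ψ (complete ij.2))
    (by simp [complete_zero]) (fun n => ?_) n
  have hprod : ∀ m, ∑ ij ∈ Finset.HasAntidiagonal.antidiagonal m, φ (complete ij.1) * ψ (complete ij.2) =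
      PowerSeries.coeff m ((PowerSeries.mk fun n => φ (complete n)) *
        PowerSeries.mk fun n => ψ (complete n)) := by
    intro m
    simp only [PowerSeries.coeff_mul, PowerSeries.coeff_mk]
  have hd : PowerSeries.derivative R ((PowerSeries.mk fun n => φ (complete n)) *
      PowerSeries.mk fun n => ψ (complete n)) =
      (PowerSeries.mk fun i => χ (MvPolynomial.X (Nat.succPNat i))) *
      ((PowerSeries.mk fun n => φ (complete n)) * PowerSeries.mk fun n => ψ (complete n)) := by
    have h1 : (PowerSeries.mk fun i => χ (MvPolynomial.X (Nat.succPNat i))) =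
        (PowerSeries.mk fun i => φ (MvPolynomial.X (Nat.succPNat i))) +
          PowerSeries.mk fun i => ψ (MvPolynomial.X (Nat.succPNat i)) := by
      ext i
      simp only [map_add, PowerSeries.coeff_mk, hχ]
    rw [Derivation.leibniz, derivative_mk_complete, derivative_mk_complete, h1, smul_eq_mul,
      smul_eq_mul]
    ring
  simp only [hprod]
  rw [mul_comm, ← PowerSeries.coeff_derivative, hd, PowerSeries.coeff_mul,
    Finset.Nat.sum_antidiagonal_eq_sum_range_succ_mk]
  simp only [PowerSeries.coeff_mk]

theorem complete_one : complete 1 = MvPolynomial.X 1 := by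
  have h := newton_complete (AlgHom.id ℚ (Sym ℚ)) 0
  have h1 : (Nat.succPNat 0 : ℕ+) = 1 := rfl
  simpa [complete_zero, h1] using h

theorem complete_two : complete 2 =
    MvPolynomial.C (1 / 2) * (MvPolynomial.X 1 ^ 2 + MvPolynomial.X 2) := by
  have h := newton_complete (AlgHom.id ℚ (Sym ℚ)) 1
  simp only [AlgHom.coe_id, id_eq, Finset.sum_range_succ, Finset.range_zero, Finset.sum_empty,
    Nat.sub_zero, complete_one, complete_zero, Nat.sub_self, mul_one, zero_add, Nat.cast_one,
    Nat.reduceAdd] at h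
  have h1 : (Nat.succPNat 0 : ℕ+) = 1 := rfl
  have h2 : (Nat.succPNat 1 : ℕ+) = 2 := rfl
  rw [h1, h2] at h
  have h3 : (MvPolynomial.C (1 / 2) : Sym ℚ) * 2 = 1 := by
    rw [show (2 : Sym ℚ) = MvPolynomial.C 2 from (map_ofNat MvPolynomial.C 2).symm,
      ← MvPolynomial.C_mul]
    norm_num
  calc complete 2 = MvPolynomial.C (1 / 2) * 2 * complete 2 := by rw [h3, one_mul]
    _ = MvPolynomial.C (1 / 2) * ((1 + 1) * complete 2) := by ring
    _ = _ := by rw [h]; ring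

end Newton

/-! ### Injectivity of the passage to power series -/

theorem coeff_powerSumSeries_mul (r : ℕ+) (g : MvPowerSeries ℕ ℚ) (d : ℕ →₀ ℕ) :
    MvPowerSeries.coeff d (powerSumSeries r * g) =
      ∑ i ∈ d.support.filter (fun i => (r : ℕ) ≤ d i),
        MvPowerSeries.coeff (d - Finsupp.single i (r : ℕ)) g := by
  classical
  have hc : ∀ e, MvPowerSeries.coeff e (powerSumSeries r) =
      if ∃ i : ℕ, e = Finsupp.single i (r : ℕ) then (1 : ℚ) else 0 := by
    intro e
    change powerSumSeries r e = _
    unfold powerSumSeries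
    split_ifs <;> rfl
  rw [MvPowerSeries.coeff_mul]
  simp only [hc, ite_mul, one_mul, zero_mul]
  rw [← Finset.sum_filter]
  symm
  refine Finset.sum_bij (fun i _ => (Finsupp.single i (r : ℕ), d - Finsupp.single i (r : ℕ)))
    ?_ ?_ ?_ ?_
  · intro i hi
    have hi' := (Finset.mem_filter.1 hi).2
    refine Finset.mem_filter.2 ⟨Finset.HasAntidiagonal.mem_antidiagonal.2 ?_, i, rfl⟩
    exact add_tsub_cancel_of_le (Finsupp.single_le_iff.2 hi')
  · intro i _ j _ hij
    exact (Finsupp.single_left_inj r.ne_zero).1 (Prod.mk.inj hij).1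
  · rintro ⟨a, b⟩ hab
    obtain ⟨h1, i, rfl⟩ := Finset.mem_filter.1 hab |>.imp_right id
    rw [Finset.HasAntidiagonal.mem_antidiagonal] at h1
    simp only at h1
    subst h1
    have hi : i ∈ (Finsupp.single i (r : ℕ) + b).support.filter
        (fun j => (r : ℕ) ≤ (Finsupp.single i (r : ℕ) + b) j) := by
      have := r.pos
      rw [Finset.mem_filter, Finsupp.mem_support_iff, Finsupp.add_apply, Finsupp.single_eq_same]
      omega
    exact ⟨i, hi, by rw [add_tsub_cancel_left]⟩
  · intro i _
    rfl

/-- The number of times each positive integer occurs among the values of `d`. -/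
def valueCount (d : ℕ →₀ ℕ) : ℕ+ →₀ ℕ :=
  ∑ i ∈ d.support, Finsupp.single (Nat.toPNat' (d i)) 1

theorem toSeries_monomial_single_add (r : ℕ+) (m : ℕ+ →₀ ℕ) :
    toSeries (MvPolynomial.monomial (Finsupp.single r 1 + m) 1) =
      powerSumSeries r * toSeries (MvPolynomial.monomial m 1) := by
  have h1 : (MvPolynomial.monomial (Finsupp.single r 1 + m) (1 : ℚ)) =
      MvPolynomial.X r * MvPolynomial.monomial m 1 := by
    rw [MvPolynomial.X, MvPolynomial.monomial_mul, one_mul]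
  rw [h1, map_mul, toSeries, MvPolynomial.aeval_X]

theorem finsupp_induction_single {P : (ℕ+ →₀ ℕ) → Prop} (h0 : P 0)
    (hs : ∀ r m, P m → P (Finsupp.single r 1 + m)) (m : ℕ+ →₀ ℕ) : P m := by
  induction m using Finsupp.induction with
  | zero => exact h0
  | single_add r n m _ _ ih =>
    clear * - ih hs
    induction n with
    | zero => simpa using ih
    | succ n ihn =>
      have h1 : Finsupp.single r (n + 1) + m = Finsupp.single r 1 + (Finsupp.single r n + m) := by
        rw [← add_assoc, ← Finsupp.single_add, add_comm n 1]
      rw [h1]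
      exact hs _ _ ihn

/-- A term of a product of power sums assigns a variable to each factor, so it involves at most as
many variables as factors. With equality each factor has its own variable, and the exponents are the
indices of the factors. Nonnegativity excludes cancellation later on. -/
theorem coeff_toSeries_monomial (m : ℕ+ →₀ ℕ) :
    ∀ d, 0 ≤ MvPowerSeries.coeff d (toSeries (MvPolynomial.monomial m 1)) ∧
      (MvPowerSeries.coeff d (toSeries (MvPolynomial.monomial m 1)) ≠ 0 →
        d.support.card ≤ m.degree ∧ (d.support.card = m.degree → valueCount d = m)) := by
  classical
  induction m using finsupp_induction_single with
  | h0 =>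
    intro d
    have h1 : toSeries (MvPolynomial.monomial 0 1) = 1 := by
      rw [MvPolynomial.monomial_zero', MvPolynomial.C_1, map_one]
    rw [h1, MvPowerSeries.coeff_one]
    split_ifs with hd
    · subst hd
      simp [valueCount]
    · simp
  | hs r m ih =>
    intro d
    rw [toSeries_monomial_single_add, coeff_powerSumSeries_mul]
    refine ⟨Finset.sum_nonneg fun i _ => (ih _).1, fun hne => ?_⟩
    obtain ⟨i, hi, hi0⟩ := Finset.exists_ne_zero_of_sum_ne_zero hne
    obtain ⟨hid, hir⟩ := Finset.mem_filter.1 hi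
    obtain ⟨h1, h2⟩ := (ih _).2 hi0
    have hdeg : (Finsupp.single r 1 + m).degree = m.degree + 1 := by
      rw [map_add, Finsupp.degree_single, add_comm]
    have hsub : d.support.erase i ⊆ (d - Finsupp.single i (r : ℕ)).support := by
      intro j hj
      rw [Finset.mem_erase, Finsupp.mem_support_iff] at hj
      rw [Finsupp.mem_support_iff, Finsupp.tsub_apply, Finsupp.single_eq_of_ne hj.1, tsub_zero]
      exact hj.2
    have hcard := Finset.card_le_card hsub
    have hcard' := Finset.card_erase_add_one hid
    refine ⟨by omega, fun heq => ?_⟩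
    have hsupp : d.support.erase i = (d - Finsupp.single i (r : ℕ)).support :=
      Finset.eq_of_subset_of_card_le hsub (by omega)
    have hdi : d i = r := by
      have h3 : i ∉ (d - Finsupp.single i (r : ℕ)).support := by
        rw [← hsupp]
        exact Finset.notMem_erase i _
      rw [Finsupp.notMem_support_iff, Finsupp.tsub_apply, Finsupp.single_eq_same] at h3
      omega
    rw [← h2 (by rw [← hsupp]; omega), valueCount, valueCount, ← hsupp,
      ← Finset.add_sum_erase _ _ hid, hdi]
    congr 1
    · congr 1
      exact PNat.coe_toPNat' r
    · refine Finset.sum_congr rfl fun j hj => ?_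
      rw [Finsupp.tsub_apply, Finsupp.single_eq_of_ne (Finset.ne_of_mem_erase hj), tsub_zero]

/-- Each new factor receives a fresh variable. -/
theorem exists_coeff_toSeries_monomial_pos (m : ℕ+ →₀ ℕ) :
    ∃ d : ℕ →₀ ℕ, d.support.card = m.degree ∧
      0 < MvPowerSeries.coeff d (toSeries (MvPolynomial.monomial m 1)) := by
  classical
  induction m using finsupp_induction_single with
  | h0 =>
    refine ⟨0, by simp, ?_⟩
    rw [MvPolynomial.monomial_zero', MvPolynomial.C_1, map_one, MvPowerSeries.coeff_zero_one]
    exact one_pos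
  | hs r m ih =>
    obtain ⟨d, hd, hpos⟩ := ih
    obtain ⟨i, hi⟩ := Infinite.exists_notMem_finset d.support
    have hdi := Finsupp.notMem_support_iff.1 hi
    refine ⟨d + Finsupp.single i (r : ℕ), ?_, ?_⟩
    · rw [Finsupp.support_add_eq, Finsupp.support_single i r.ne_zero,
        Finset.card_union_of_disjoint, hd, map_add, Finsupp.degree_single, Finset.card_singleton,
        add_comm]
      · simpa using hdi
      · rw [Finsupp.support_single i r.ne_zero]
        simpa using hdi
    · rw [toSeries_monomial_single_add, coeff_powerSumSeries_mul]
      refine Finset.sum_pos' (fun j _ => (coeff_toSeries_monomial m _).1) ⟨i, ?_, ?_⟩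
      · have := r.pos
        rw [Finset.mem_filter, Finsupp.mem_support_iff, Finsupp.add_apply,
          Finsupp.single_eq_same]
        omega
      · rwa [add_tsub_cancel_right]

/-- Among the monomials of f, take one with the most factors, and an exponent d that gives each
factor its own variable. Every other monomial has at most as many factors, and could reach d only
with the same `valueCount`; hence the coefficient at d does not vanish. -/
theorem toSeries_injective : Function.Injective toSeries := by
  rw [injective_iff_map_eq_zero]
  intro f hf
  by_contra hne
  obtain ⟨m, hm, hmax⟩ := Finset.exists_max_image f.support (fun m => m.degree)
    (MvPolynomial.support_nonempty.2 hne)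
  obtain ⟨d, hd, hpos⟩ := exists_coeff_toSeries_monomial_pos m
  have h1 : MvPowerSeries.coeff d (toSeries f) = ∑ n ∈ f.support,
      f.coeff n * MvPowerSeries.coeff d (toSeries (MvPolynomial.monomial n 1)) := by
    conv_lhs => rw [f.as_sum, map_sum, map_sum]
    refine Finset.sum_congr rfl fun n _ => ?_
    have h2 : MvPolynomial.monomial n (f.coeff n) =
        f.coeff n • MvPolynomial.monomial n (1 : ℚ) := by
      rw [MvPolynomial.smul_monomial, smul_eq_mul, mul_one]
    rw [h2, map_smul, MvPowerSeries.coeff_smul]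
  rw [hf, map_zero, Finset.sum_eq_single m] at h1
  · exact mul_ne_zero (MvPolynomial.mem_support_iff.1 hm) hpos.ne' h1.symm
  · intro n hn hnm
    by_contra hcoef
    obtain ⟨h2, h3⟩ := (coeff_toSeries_monomial n d).2 (right_ne_zero_of_mul hcoef)
    have h4 := hmax n hn
    obtain ⟨-, h5⟩ := (coeff_toSeries_monomial m d).2 hpos.ne'
    exact hnm ((h3 (le_antisymm h2 (by omega))).symm.trans (h5 hd))
  · exact fun h => absurd hm h

/-! ### Schur polynomials in finitely many variables -/

section SchurPoly

variable {R : Type*} [CommRing R]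

open Classical in
/-- The Schur polynomial of `μ` in `x 0, …, x (n - 1)`, defined by the branching rule. -/
def schurPoly (x : ℕ → R) : ℕ → YoungDiagram → R
  | 0, μ => if μ = ⊥ then 1 else 0
  | n + 1, μ => ∑ κ ∈ stripsBelow μ, x n ^ (μ.card - κ.card) * schurPoly x n κ

open Classical in
theorem sum_stripsAbove_antidiagonal (κ : YoungDiagram) (k : ℕ) (F : ℕ → YoungDiagram → R) :
    ∑ ij ∈ Finset.HasAntidiagonal.antidiagonal k, ∑ ν ∈ stripsAbove κ ij.1, F ij.2 ν =
      ∑ ν ∈ (partitionsLE (κ.card + k)).filter (fun ν => HStrip κ ν),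
        F (κ.card + k - ν.card) ν := by
  rw [Finset.sum_sigma']
  refine Finset.sum_bij' (fun p _ => p.2)
    (fun ν _ => ⟨(ν.card - κ.card, κ.card + k - ν.card), ν⟩) ?_ ?_ ?_ ?_ ?_
  · rintro ⟨⟨i, j⟩, ν⟩ h
    simp only [Finset.mem_sigma, Finset.HasAntidiagonal.mem_antidiagonal, mem_stripsAbove,
      Finset.mem_filter, mem_partitionsLE] at h ⊢
    exact ⟨by omega, h.2.2⟩
  · intro ν h
    simp only [Finset.mem_sigma, Finset.HasAntidiagonal.mem_antidiagonal, mem_stripsAbove,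
      Finset.mem_filter, mem_partitionsLE] at h ⊢
    have := h.2.card_le
    exact ⟨by omega, by omega, h.2⟩
  · rintro ⟨⟨i, j⟩, ν⟩ h
    simp only [Finset.mem_sigma, Finset.HasAntidiagonal.mem_antidiagonal, mem_stripsAbove] at h
    have h1 : ν.card - κ.card = i := by omega
    have h2 : κ.card + k - ν.card = j := by omega
    simp only [h1, h2]
  · intro ν _
    rfl
  · rintro ⟨⟨i, j⟩, ν⟩ h
    simp only [Finset.mem_sigma, Finset.HasAntidiagonal.mem_antidiagonal, mem_stripsAbove] at h
    have h2 : κ.card + k - ν.card = j := by omega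
    simp only [h2]

open Classical in
-- Collecting by the shape left after peeling the last variable gives multiplicities that are counts
-- of shapes above κ, the form to which the strip counts apply.
theorem sum_schurPoly_succ (x : ℕ → R) (n N : ℕ) (P : YoungDiagram → Prop) :
    ∑ ν ∈ (partitions N).filter P, schurPoly x (n + 1) ν =
      ∑ κ ∈ partitionsLE N, ((partitions N).filter fun ν => P ν ∧ HStrip κ ν).card •
        (x n ^ (N - κ.card) * schurPoly x n κ) := by
  have h1 : ∀ ν ∈ (partitions N).filter P, schurPoly x (n + 1) ν =
      ∑ κ ∈ stripsBelow ν, x n ^ (N - κ.card) * schurPoly x n κ := by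
    intro ν hν
    rw [schurPoly, mem_partitions.1 (Finset.mem_filter.1 hν).1]
  simp only [← Finset.sum_const]
  rw [Finset.sum_congr rfl h1]
  refine Finset.sum_comm' fun ν κ => ?_
  simp only [Finset.mem_filter, mem_partitionsLE, mem_stripsBelow, mem_partitions]
  constructor
  · rintro ⟨⟨h1, h2⟩, h3⟩
    exact ⟨⟨h1, h2, h3⟩, h1 ▸ h3.card_le⟩
  · rintro ⟨⟨h1, h2, h3⟩, -⟩
    exact ⟨⟨h1, h2⟩, h3⟩

open Classical in
theorem schurPoly_zero_sum (x : ℕ → R) (k : ℕ) (P : YoungDiagram → Prop) (hP : P ⊥) :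
    ∑ ν ∈ (partitions (2 * k)).filter P, schurPoly x 0 ν = if k = 0 then 1 else 0 := by
  simp only [schurPoly, Finset.sum_ite_eq', Finset.mem_filter, mem_partitions]
  refine if_congr ?_ rfl rfl
  rw [card_eq_zero_iff.2 rfl, and_iff_left hP]
  omega

variable [Algebra ℚ R]

/-- The evaluation of symmetric functions at `x 0, …, x (n - 1)`. -/
def evalVars (x : ℕ → R) (n : ℕ) : Sym ℚ →ₐ[ℚ] R :=
  MvPolynomial.aeval fun r : ℕ+ => ∑ i ∈ Finset.range n, x i ^ (r : ℕ)

theorem evalVars_X (x : ℕ → R) (n : ℕ) (r : ℕ+) :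
    evalVars x n (MvPolynomial.X r) = ∑ i ∈ Finset.range n, x i ^ (r : ℕ) := by
  rw [evalVars, MvPolynomial.aeval_X]

theorem evalVars_zero_complete (x : ℕ → R) (k : ℕ) :
    evalVars x 0 (complete k) = if k = 0 then 1 else 0 :=
  complete_of_zero _ (fun r => by rw [evalVars_X, Finset.range_zero, Finset.sum_empty]) k

theorem evalVars_succ_complete (x : ℕ → R) (n k : ℕ) :
    evalVars x (n + 1) (complete k) = ∑ ij ∈ Finset.HasAntidiagonal.antidiagonal k,
      evalVars x n (complete ij.1) * x n ^ ij.2 := by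
  rw [complete_of_add (evalVars x n) (MvPolynomial.aeval fun r : ℕ+ => x n ^ (r : ℕ))
    (evalVars x (n + 1))
    (fun r => by rw [evalVars_X, evalVars_X, Finset.sum_range_succ, MvPolynomial.aeval_X])]
  refine Finset.sum_congr rfl fun ij _ => ?_
  rw [complete_of_pow (MvPolynomial.aeval fun r : ℕ+ => x n ^ (r : ℕ)) (x n)
    (fun r => by rw [MvPolynomial.aeval_X])]

open Classical in
/-- **Pieri's formula** for Schur polynomials. -/
theorem complete_mul_schurPoly (x : ℕ → R) (n k : ℕ) (μ : YoungDiagram) :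
    evalVars x n (complete k) * schurPoly x n μ = ∑ l ∈ stripsAbove μ k, schurPoly x n l := by
  induction n generalizing k μ with
  | zero =>
    simp only [schurPoly, evalVars_zero_complete, Finset.sum_ite_eq', mem_stripsAbove]
    have h1 : ((⊥ : YoungDiagram).card = μ.card + k ∧ HStrip μ ⊥) ↔ k = 0 ∧ μ = ⊥ := by
      rw [card_eq_zero_iff.2 rfl]
      constructor
      · rintro ⟨h1, -⟩
        exact ⟨by omega, card_eq_zero_iff.1 (by omega)⟩
      · rintro ⟨rfl, rfl⟩
        exact ⟨by rw [card_eq_zero_iff.2 rfl], hStrip_iff_rowLen.2 fun i => by simp [rowLen_bot]⟩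
    rw [if_congr h1 rfl rfl, ite_and]
    split_ifs <;> simp
  | succ n ih =>
    -- Both sides are expanded in x_n and collected by the remaining shape ν, with the same power of
    -- x_n. The left side counts shapes below μ and ν, the right side shapes above both.
    have hl : evalVars x (n + 1) (complete k) * schurPoly x (n + 1) μ =
        ∑ ν ∈ partitionsLE (μ.card + k),
          ∑ κ ∈ (stripsBelow μ).filter
            (fun κ => HStrip κ ν ∧ μ.card + ν.card ≤ μ.card + k + κ.card),
            x n ^ (μ.card + k - ν.card) * schurPoly x n ν := by
      rw [evalVars_succ_complete, schurPoly, Finset.mul_sum]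
      have h1 : ∀ κ ∈ stripsBelow μ,
          (∑ ij ∈ Finset.HasAntidiagonal.antidiagonal k,
            evalVars x n (complete ij.1) * x n ^ ij.2) *
            (x n ^ (μ.card - κ.card) * schurPoly x n κ) =
          ∑ ν ∈ (partitionsLE (κ.card + k)).filter (fun ν => HStrip κ ν),
            x n ^ (μ.card + k - ν.card) * schurPoly x n ν := by
        intro κ hκ
        have hκμ := (mem_stripsBelow.1 hκ).card_le
        have h2 : ∀ ij ∈ Finset.HasAntidiagonal.antidiagonal k,
            evalVars x n (complete ij.1) * x n ^ ij.2 *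
              (x n ^ (μ.card - κ.card) * schurPoly x n κ) =
            ∑ ν ∈ stripsAbove κ ij.1, x n ^ (ij.2 + (μ.card - κ.card)) * schurPoly x n ν := by
          intro ij _
          rw [← Finset.mul_sum, ← ih, pow_add]
          ring
        rw [Finset.sum_mul, Finset.sum_congr rfl h2, sum_stripsAbove_antidiagonal κ k
          (fun j ν => x n ^ (j + (μ.card - κ.card)) * schurPoly x n ν)]
        refine Finset.sum_congr rfl fun ν hν => ?_
        have := mem_partitionsLE.1 (Finset.mem_filter.1 hν).1
        congr 2
        omega
      rw [Finset.sum_congr rfl h1]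
      refine Finset.sum_comm' fun κ ν => ?_
      simp only [Finset.mem_filter, mem_partitionsLE, mem_stripsBelow]
      constructor
      · rintro ⟨h1, h2, h3⟩
        have := h1.card_le
        exact ⟨⟨h1, h3, by omega⟩, by omega⟩
      · rintro ⟨⟨h1, h3, h2⟩, -⟩
        exact ⟨h1, by omega, h3⟩
    have hr : ∑ l ∈ stripsAbove μ k, schurPoly x (n + 1) l =
        ∑ ν ∈ partitionsLE (μ.card + k),
          ∑ l ∈ (partitions (μ.card + k)).filter (fun l => HStrip μ l ∧ HStrip ν l),
            x n ^ (μ.card + k - ν.card) * schurPoly x n ν := by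
      have h1 : ∀ l ∈ stripsAbove μ k, schurPoly x (n + 1) l =
          ∑ ν ∈ stripsBelow l, x n ^ (μ.card + k - ν.card) * schurPoly x n ν := by
        intro l hl
        rw [schurPoly, (mem_stripsAbove.1 hl).1]
      rw [Finset.sum_congr rfl h1]
      refine Finset.sum_comm' fun l ν => ?_
      simp only [Finset.mem_filter, mem_partitionsLE, mem_stripsBelow, mem_partitions,
        mem_stripsAbove]
      constructor
      · rintro ⟨⟨h1, h2⟩, h3⟩
        exact ⟨⟨h1, h2, h3⟩, h1 ▸ h3.card_le⟩
      · rintro ⟨⟨h1, h2, h3⟩, -⟩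
        exact ⟨⟨h1, h2⟩, h3⟩
    rw [hl, hr]
    refine Finset.sum_congr rfl fun ν _ => ?_
    rw [Finset.sum_const, Finset.sum_const, card_common_strips]

open Classical in
/-- Pieri's formula for `e₂ = h₁² - h₂`. -/
theorem elementary_two_mul_schurPoly (x : ℕ → R) (n : ℕ) (ν : YoungDiagram) :
    evalVars x n (complete 1 ^ 2 - complete 2) * schurPoly x n ν =
      ∑ μ ∈ (partitions (ν.card + 2)).filter (fun μ => VStrip ν μ), schurPoly x n μ := by
  have h1 : evalVars x n (complete 1) * (evalVars x n (complete 1) * schurPoly x n ν) =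
      ∑ μ ∈ partitions (ν.card + 2), ∑ κ ∈ (stripsAbove ν 1).filter (fun κ => HStrip κ μ),
        schurPoly x n μ := by
    rw [complete_mul_schurPoly, Finset.mul_sum,
      Finset.sum_congr rfl fun κ _ => complete_mul_schurPoly x n 1 κ]
    refine Finset.sum_comm' fun κ μ => ?_
    simp only [Finset.mem_filter, mem_partitions, mem_stripsAbove]
    constructor
    · rintro ⟨⟨h1, h2⟩, h3, h4⟩
      exact ⟨⟨⟨h1, h2⟩, h4⟩, by omega⟩
    · rintro ⟨⟨⟨h1, h2⟩, h4⟩, h3⟩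
      exact ⟨⟨h1, h2⟩, by omega, h4⟩
  have h2 : ∀ μ ∈ partitions (ν.card + 2),
      ∑ κ ∈ (stripsAbove ν 1).filter (fun κ => HStrip κ μ), schurPoly x n μ =
        (if HStrip ν μ then schurPoly x n μ else 0) +
          if VStrip ν μ then schurPoly x n μ else 0 := by
    intro μ hμ
    rw [Finset.sum_const, card_chains (mem_partitions.1 hμ), add_nsmul]
    split_ifs <;> simp
  rw [map_sub, map_pow, sub_mul, pow_two, mul_assoc, h1, complete_mul_schurPoly,
    Finset.sum_congr rfl h2, Finset.sum_add_distrib, ← Finset.sum_filter, ← Finset.sum_filter,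
    stripsAbove, add_sub_cancel_left]

/-! ### Littlewood's identities -/

/-- The plethysm `f ↦ f[e₂]` in the variables `x 0, …, x (n - 1)`. -/
def evalPairs (x : ℕ → R) (n : ℕ) : Sym ℚ →ₐ[ℚ] R :=
  MvPolynomial.aeval fun r : ℕ+ => algebraMap ℚ R (1 / 2) *
    (evalVars x n (MvPolynomial.X r) ^ 2 - evalVars x n (MvPolynomial.X (r * 2)))

/-- The plethysm `f ↦ f[h₂]` in the variables `x 0, …, x (n - 1)`. -/
def evalMultipairs (x : ℕ → R) (n : ℕ) : Sym ℚ →ₐ[ℚ] R :=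
  MvPolynomial.aeval fun r : ℕ+ => algebraMap ℚ R (1 / 2) *
    (evalVars x n (MvPolynomial.X r) ^ 2 + evalVars x n (MvPolynomial.X (r * 2)))

theorem half_mul_two : algebraMap ℚ R (1 / 2) * 2 = 1 := by
  rw [show (2 : R) = algebraMap ℚ R 2 from (map_ofNat (algebraMap ℚ R) 2).symm, ← map_mul]
  norm_num

/-- Adjoining x_n changes e_2 into e_2 + x_n p_1, and h_k of a sum is a convolution. -/
theorem evalPairs_succ_complete (x : ℕ → R) (n k : ℕ) :
    evalPairs x (n + 1) (complete k) = ∑ ij ∈ Finset.HasAntidiagonal.antidiagonal k,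
      evalPairs x n (complete ij.1) * (x n ^ ij.2 * evalVars x n (complete ij.2)) := by
  rw [complete_of_add (evalPairs x n) (MvPolynomial.aeval fun r : ℕ+ =>
    x n ^ (r : ℕ) * evalVars x n (MvPolynomial.X r)) (evalPairs x (n + 1))]
  · refine Finset.sum_congr rfl fun ij _ => ?_
    rw [complete_of_scaled (MvPolynomial.aeval fun r : ℕ+ =>
      x n ^ (r : ℕ) * evalVars x n (MvPolynomial.X r)) (evalVars x n) (x n) fun r => by rw [MvPolynomial.aeval_X]]
  · intro r
    simp only [evalPairs, MvPolynomial.aeval_X, evalVars_X, Finset.sum_range_succ, PNat.mul_coe,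
      PNat.val_ofNat, pow_mul]
    linear_combination (x n ^ (r : ℕ) * ∑ i ∈ Finset.range n, x i ^ (r : ℕ)) *
      half_mul_two (R := R)

/-- Adjoining x_n changes h_2 into h_2 + x_n p_1 + x_n²; the last term gives the outer convolution.
-/
theorem evalMultipairs_succ_complete (x : ℕ → R) (n k : ℕ) :
    evalMultipairs x (n + 1) (complete k) =
      ∑ ml ∈ Finset.HasAntidiagonal.antidiagonal k,
        (∑ ij ∈ Finset.HasAntidiagonal.antidiagonal ml.1, evalMultipairs x n (complete ij.1) *
          (x n ^ ij.2 * evalVars x n (complete ij.2))) * (x n ^ 2) ^ ml.2 := by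
  let φ : Sym ℚ →ₐ[ℚ] R := MvPolynomial.aeval fun r : ℕ+ =>
    evalMultipairs x n (MvPolynomial.X r) + x n ^ (r : ℕ) * evalVars x n (MvPolynomial.X r)
  rw [complete_of_add φ (MvPolynomial.aeval fun r : ℕ+ => (x n ^ 2) ^ (r : ℕ))
    (evalMultipairs x (n + 1))]
  · refine Finset.sum_congr rfl fun ml _ => ?_
    rw [complete_of_pow (MvPolynomial.aeval fun r : ℕ+ => (x n ^ 2) ^ (r : ℕ)) (x n ^ 2)
      fun r => by rw [MvPolynomial.aeval_X],
      complete_of_add (evalMultipairs x n) (MvPolynomial.aeval fun r : ℕ+ =>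
        x n ^ (r : ℕ) * evalVars x n (MvPolynomial.X r)) φ
        fun r => by simp only [φ, MvPolynomial.aeval_X]]
    congr 1
    refine Finset.sum_congr rfl fun ij _ => ?_
    rw [complete_of_scaled (MvPolynomial.aeval fun r : ℕ+ =>
      x n ^ (r : ℕ) * evalVars x n (MvPolynomial.X r)) (evalVars x n) (x n) fun r => by rw [MvPolynomial.aeval_X]]
  · intro r
    simp only [φ, evalMultipairs, MvPolynomial.aeval_X, evalVars_X, Finset.sum_range_succ,
      PNat.mul_coe, PNat.val_ofNat, pow_mul]
    rw [pow_right_comm (x n) 2]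
    linear_combination (x n ^ (r : ℕ) * (∑ i ∈ Finset.range n, x i ^ (r : ℕ)) +
      (x n ^ (r : ℕ)) ^ 2) * half_mul_two (R := R)

theorem IsEven.even_card {ν : YoungDiagram} (h : IsEven ν) : Even ν.card := by
  rw [card_eq_sum_colLen (colLen_eq_zero_of_card_le le_rfl)]
  exact Finset.even_sum _ fun i _ => h i

theorem EvenRows.even_card {ν : YoungDiagram} (h : EvenRows ν) : Even ν.card := by
  rw [card_eq_sum_rowLen (rowLen_card ν)]
  exact Finset.even_sum _ fun i _ => h i

open Classical in
/-- **Littlewood's identity**: `h_k[e₂]` is the sum of the Schur functions of the partitions of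
`2k` with even columns. -/
theorem evalPairs_complete (x : ℕ → R) (n k : ℕ) :
    evalPairs x n (complete k) = ∑ ν ∈ (partitions (2 * k)).filter IsEven, schurPoly x n ν := by
  induction n generalizing k with
  | zero =>
    rw [schurPoly_zero_sum x k IsEven fun j => by
      rw [← YoungDiagram.rowLen_transpose, show (⊥ : YoungDiagram).transpose = ⊥ from
        card_eq_zero_iff.1 (by rw [card_transpose, card_eq_zero_iff.2 rfl]), rowLen_bot]
      exact Even.zero]
    exact complete_of_zero _ (fun r => by simp [evalPairs, evalVars_X]) k
  | succ n ih =>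
    rw [sum_schurPoly_succ, evalPairs_succ_complete]
    -- Even shapes above κ are traded for even shapes ν below it, as in the recursion. There |ν| =
    -- 2i, |κ| = 2i + j and i + j = k, which is the relation 2|κ| = 2k + |ν|.
    simp only [card_evenCols_strips, ← Finset.sum_const]
    have h1 : ∀ ij ∈ Finset.HasAntidiagonal.antidiagonal k, evalPairs x n (complete ij.1) *
        (x n ^ ij.2 * evalVars x n (complete ij.2)) =
        ∑ ν ∈ (partitions (2 * ij.1)).filter IsEven, ∑ κ ∈ stripsAbove ν ij.2,
          x n ^ ij.2 * schurPoly x n κ := by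
      intro ij _
      rw [ih, Finset.sum_mul]
      refine Finset.sum_congr rfl fun ν _ => ?_
      rw [← Finset.mul_sum, ← complete_mul_schurPoly]
      ring
    rw [Finset.sum_congr rfl h1, Finset.sum_sigma', Finset.sum_sigma', Finset.sum_sigma']
    refine Finset.sum_bij' (fun p _ => ⟨p.2, p.1.2⟩)
      (fun q _ => ⟨⟨(q.2.card / 2, k - q.2.card / 2), q.2⟩, q.1⟩) ?_ ?_ ?_ ?_ ?_
    · rintro ⟨⟨⟨i, j⟩, ν⟩, κ⟩ h
      simp only [Finset.mem_sigma, Finset.HasAntidiagonal.mem_antidiagonal, mem_stripsAbove,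
        Finset.mem_filter, mem_partitions, mem_partitionsLE, mem_stripsBelow] at h ⊢
      obtain ⟨⟨h1, h2, h3⟩, h4, h5⟩ := h
      exact ⟨by omega, h5, h3, by omega⟩
    · rintro ⟨κ, ν⟩ h
      simp only [Finset.mem_sigma, Finset.HasAntidiagonal.mem_antidiagonal, mem_stripsAbove,
        Finset.mem_filter, mem_partitions, mem_partitionsLE, mem_stripsBelow] at h ⊢
      obtain ⟨h1, h2, h3, h4⟩ := h
      obtain ⟨a, ha⟩ := h3.even_card
      exact ⟨⟨by omega, by omega, h3⟩, by omega, h2⟩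
    · rintro ⟨⟨⟨i, j⟩, ν⟩, κ⟩ h
      simp only [Finset.mem_sigma, Finset.HasAntidiagonal.mem_antidiagonal, mem_stripsAbove,
        Finset.mem_filter, mem_partitions] at h
      have h1 : ν.card / 2 = i := by omega
      have h2 : k - i = j := by omega
      simp only [h1, h2]
    · rintro ⟨κ, ν⟩ _
      rfl
    · rintro ⟨⟨⟨i, j⟩, ν⟩, κ⟩ h
      simp only [Finset.mem_sigma, Finset.HasAntidiagonal.mem_antidiagonal, mem_stripsAbove,
        Finset.mem_filter, mem_partitions] at h
      have h1 : 2 * k - κ.card = j := by omega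
      simp only [h1]

open Classical in
/-- **Littlewood's identity**: `h_k[h₂]` is the sum of the Schur functions of the partitions of
`2k` with even rows. -/
theorem evalMultipairs_complete (x : ℕ → R) (n k : ℕ) :
    evalMultipairs x n (complete k) =
      ∑ ν ∈ (partitions (2 * k)).filter EvenRows, schurPoly x n ν := by
  induction n generalizing k with
  | zero =>
    rw [schurPoly_zero_sum x k EvenRows fun j => by
      rw [rowLen_bot]
      exact Even.zero]
    exact complete_of_zero _ (fun r => by simp [evalMultipairs, evalVars_X]) k
  | succ n ih =>
    rw [sum_schurPoly_succ, evalMultipairs_succ_complete]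
    -- Here |ν| = 2i, |κ| = 2i + j and i + j + l = k, so 2|κ| = 2(k - l) + |ν|: the exponent l of
    -- x_n² measures the slack in the inequality.
    simp only [card_evenRows_strips, ← Finset.sum_const]
    have h1 : ∀ ml ∈ Finset.HasAntidiagonal.antidiagonal k,
        (∑ ij ∈ Finset.HasAntidiagonal.antidiagonal ml.1, evalMultipairs x n (complete ij.1) *
          (x n ^ ij.2 * evalVars x n (complete ij.2))) * (x n ^ 2) ^ ml.2 =
        ∑ ij ∈ Finset.HasAntidiagonal.antidiagonal ml.1,
          ∑ ν ∈ (partitions (2 * ij.1)).filter EvenRows, ∑ κ ∈ stripsAbove ν ij.2,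
            x n ^ (ij.2 + 2 * ml.2) * schurPoly x n κ := by
      intro ml _
      rw [Finset.sum_mul]
      refine Finset.sum_congr rfl fun ij _ => ?_
      rw [ih, Finset.sum_mul, Finset.sum_mul]
      refine Finset.sum_congr rfl fun ν _ => ?_
      rw [← Finset.mul_sum, ← complete_mul_schurPoly, pow_add, pow_mul]
      ring
    rw [Finset.sum_congr rfl h1, Finset.sum_sigma', Finset.sum_sigma', Finset.sum_sigma',
      Finset.sum_sigma']
    refine Finset.sum_bij' (fun p _ => ⟨p.2, p.1.2⟩)
      (fun q _ => ⟨⟨⟨(q.1.card - q.2.card / 2, k - (q.1.card - q.2.card / 2)),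
        (q.2.card / 2, q.1.card - q.2.card)⟩, q.2⟩, q.1⟩) ?_ ?_ ?_ ?_ ?_
    · rintro ⟨⟨⟨⟨m, l⟩, i, j⟩, ν⟩, κ⟩ h
      simp only [Finset.mem_sigma, Finset.HasAntidiagonal.mem_antidiagonal, mem_stripsAbove,
        Finset.mem_filter, mem_partitions, mem_partitionsLE, mem_stripsBelow] at h ⊢
      obtain ⟨⟨⟨h0, h1⟩, h2, h3⟩, h4, h5⟩ := h
      exact ⟨by omega, h5, h3, by omega⟩
    · rintro ⟨κ, ν⟩ h
      simp only [Finset.mem_sigma, Finset.HasAntidiagonal.mem_antidiagonal, mem_stripsAbove,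
        Finset.mem_filter, mem_partitions, mem_partitionsLE, mem_stripsBelow] at h ⊢
      obtain ⟨h1, h2, h3, h4⟩ := h
      obtain ⟨a, ha⟩ := h3.even_card
      have := h2.card_le
      exact ⟨⟨⟨by omega, by omega⟩, by omega, h3⟩, by omega, h2⟩
    · rintro ⟨⟨⟨⟨m, l⟩, i, j⟩, ν⟩, κ⟩ h
      simp only [Finset.mem_sigma, Finset.HasAntidiagonal.mem_antidiagonal, mem_stripsAbove,
        Finset.mem_filter, mem_partitions] at h
      have h1 : ν.card / 2 = i := by omega
      have h2 : κ.card - ν.card = j := by omega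
      have h3 : κ.card - i = m := by omega
      have h4 : k - m = l := by omega
      simp only [h1, h2, h3, h4]
    · rintro ⟨κ, ν⟩ _
      rfl
    · rintro ⟨⟨⟨⟨m, l⟩, i, j⟩, ν⟩, κ⟩ h
      simp only [Finset.mem_sigma, Finset.HasAntidiagonal.mem_antidiagonal, mem_stripsAbove,
        Finset.mem_filter, mem_partitions] at h
      have h1 : 2 * k - κ.card = j + 2 * l := by omega
      simp only [h1]

end SchurPoly

/-! ### Tableaux and the branching rule -/

theorem weight_apply_ne_zero {μ : YoungDiagram} (T : SemistandardYoungTableau μ) {c : ℕ × ℕ}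
    (hc : c ∈ μ) : weight T (T c.1 c.2) ≠ 0 := by
  rw [weight, Finsupp.finsetSum_apply, ← Nat.pos_iff_ne_zero]
  exact Finset.sum_pos' (fun _ _ => Nat.zero_le _) ⟨c, hc, by simp⟩

theorem weight_apply_eq_zero {μ : YoungDiagram} (T : SemistandardYoungTableau μ) {i : ℕ}
    (h : ∀ c ∈ μ, T c.1 c.2 ≠ i) : weight T i = 0 := by
  rw [weight, Finsupp.finsetSum_apply]
  exact Finset.sum_eq_zero fun c hc => Finsupp.single_eq_of_ne (h c hc).symm

theorem weight_eq_add_single {κ μ : YoungDiagram} (hle : κ ≤ μ) (T : SemistandardYoungTableau μ)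
    (T' : SemistandardYoungTableau κ) {n : ℕ} (h1 : ∀ i j, (i, j) ∈ κ → T i j = T' i j)
    (h2 : ∀ i j, (i, j) ∈ μ → (i, j) ∉ κ → T i j = n) :
    weight T = weight T' + Finsupp.single n (μ.card - κ.card) := by
  have hsub : κ.cells ⊆ μ.cells := hle
  rw [weight, weight, ← Finset.sum_sdiff hsub, add_comm]
  congr 1
  · exact Finset.sum_congr rfl fun c hc => by rw [h1 c.1 c.2 hc]
  · have h3 : ∀ c ∈ μ.cells \ κ.cells, Finsupp.single (T c.1 c.2) 1 = Finsupp.single n 1 := by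
      intro c hc
      obtain ⟨hc1, hc2⟩ := Finset.mem_sdiff.1 hc
      rw [h2 c.1 c.2 hc1 hc2]
    rw [Finset.sum_congr rfl h3, Finset.sum_const, Finset.card_sdiff_of_subset hsub,
      Finsupp.smul_single, smul_eq_mul, mul_one]

/-- All entries lie in the support of d. Finiteness makes `Nat.card` a true count rather than the
default 0. -/
theorem finite_tableaux (μ : YoungDiagram) (d : ℕ →₀ ℕ) :
    Finite {T : SemistandardYoungTableau μ // weight T = d} := by
  refine Finite.of_injective (β := μ.cells → d.support) (fun T c => ⟨T.1 c.1.1 c.1.2, ?_⟩) ?_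
  · rw [Finsupp.mem_support_iff]
    exact fun h => weight_apply_ne_zero T.1 c.2 (by rw [T.2, h])
  · intro T T' h
    refine Subtype.ext (SemistandardYoungTableau.ext fun i j => ?_)
    by_cases hc : (i, j) ∈ μ
    · exact congrArg Subtype.val (congrFun h ⟨(i, j), hc⟩)
    · rw [T.1.zeros hc, T'.1.zeros hc]

/-- The cells of a tableau with entries smaller than `n`. -/
def shapeBelow (n : ℕ) {μ : YoungDiagram} (T : SemistandardYoungTableau μ) : YoungDiagram where
  cells := μ.cells.filter fun c => T c.1 c.2 < n
  isLowerSet := by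
    rintro ⟨a, b⟩ ⟨c, d⟩ ⟨hca, hdb⟩ hab
    simp only [Finset.coe_filter, YoungDiagram.mem_cells, Set.mem_ofPred_eq] at hab hca hdb ⊢
    refine ⟨μ.up_left_mem hca hdb hab.1, ?_⟩
    have h1 := T.row_weak_of_le hdb hab.1
    have h2 := T.col_weak hca (μ.up_left_mem le_rfl hdb hab.1)
    omega

theorem mem_shapeBelow {n : ℕ} {μ : YoungDiagram} {T : SemistandardYoungTableau μ} {c : ℕ × ℕ} :
    c ∈ shapeBelow n T ↔ c ∈ μ ∧ T c.1 c.2 < n :=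
  Finset.mem_filter

theorem hStrip_shapeBelow {n : ℕ} {μ : YoungDiagram} {T : SemistandardYoungTableau μ}
    (hT : ∀ c ∈ μ, T c.1 c.2 < n + 1) : HStrip (shapeBelow n T) μ := by
  refine ⟨fun c hc => (mem_shapeBelow.1 hc).1, fun i j hij => mem_shapeBelow.2 ⟨?_, ?_⟩⟩
  · exact μ.up_left_mem (Nat.le_succ i) le_rfl hij
  · have h1 : T i j < T (i + 1) j := T.col_strict (Nat.lt_succ_self i) hij
    have h2 := hT _ hij
    simp only at h2 ⊢
    omega

/-- The restriction of a tableau to a smaller diagram. -/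
def restrictTableau {κ μ : YoungDiagram} (hle : κ ≤ μ) (T : SemistandardYoungTableau μ) :
    SemistandardYoungTableau κ where
  entry i j := if (i, j) ∈ κ then T i j else 0
  row_weak' {i j1 j2} hj hc := by
    rw [if_pos hc, if_pos (κ.up_left_mem le_rfl hj.le hc)]
    exact T.row_weak hj (hle hc)
  col_strict' {i1 i2 j} hi hc := by
    rw [if_pos hc, if_pos (κ.up_left_mem hi.le le_rfl hc)]
    exact T.col_strict hi (hle hc)
  zeros' hc := if_neg hc

theorem restrictTableau_apply {κ μ : YoungDiagram} (hle : κ ≤ μ) (T : SemistandardYoungTableau μ)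
    {i j : ℕ} (hc : (i, j) ∈ κ) : restrictTableau hle T i j = T i j :=
  if_pos hc

/-- The extension of a tableau by a horizontal strip of entries `n`. -/
def extendTableau {κ μ : YoungDiagram} (hs : HStrip κ μ) {n : ℕ} (T : SemistandardYoungTableau κ)
    (hT : ∀ i j, (i, j) ∈ κ → T i j < n) : SemistandardYoungTableau μ where
  entry i j := if (i, j) ∈ κ then T i j else if (i, j) ∈ μ then n else 0
  row_weak' {i j1 j2} hj hc := by
    by_cases h2 : (i, j2) ∈ κ
    · rw [if_pos h2, if_pos (κ.up_left_mem le_rfl hj.le h2)]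
      exact T.row_weak hj h2
    · rw [if_neg h2, if_pos hc]
      split_ifs with h1
      · exact (hT _ _ h1).le
      · exact le_rfl
      · exact Nat.zero_le n
  col_strict' {i1 i2 j} hi hc := by
    have h1 : (i1, j) ∈ κ := by
      obtain ⟨k, rfl⟩ : ∃ k, i2 = k + 1 := ⟨i2 - 1, by omega⟩
      exact κ.up_left_mem (Nat.le_of_lt_succ hi) le_rfl (hs.2 k j hc)
    rw [if_pos h1]
    by_cases h2 : (i2, j) ∈ κ
    · rw [if_pos h2]
      exact T.col_strict hi h2
    · rw [if_neg h2, if_pos hc]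
      exact hT _ _ h1
  zeros' {i j} hc := by
    rw [if_neg fun h => hc (hs.le h), if_neg hc]

theorem extendTableau_apply_of_mem {κ μ : YoungDiagram} (hs : HStrip κ μ) {n : ℕ}
    (T : SemistandardYoungTableau κ) (hT : ∀ i j, (i, j) ∈ κ → T i j < n) {i j : ℕ}
    (hc : (i, j) ∈ κ) : extendTableau hs T hT i j = T i j :=
  if_pos hc

theorem extendTableau_apply_of_notMem {κ μ : YoungDiagram} (hs : HStrip κ μ) {n : ℕ}
    (T : SemistandardYoungTableau κ) (hT : ∀ i j, (i, j) ∈ κ → T i j < n) {i j : ℕ}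
    (hc : (i, j) ∈ μ) (hc' : (i, j) ∉ κ) : extendTableau hs T hT i j = n :=
  (if_neg hc').trans (if_pos hc)

section Branching

variable {n : ℕ} {d : ℕ →₀ ℕ} {κ μ : YoungDiagram}

theorem entry_lt_of_weight {T : SemistandardYoungTableau μ} (hd : ∀ i, n ≤ i → d i = 0)
    (hT : weight T = d) {c : ℕ × ℕ} (hc : c ∈ μ) : T c.1 c.2 < n := by
  by_contra! h
  exact weight_apply_ne_zero T hc (by rw [hT, hd _ h])

theorem weight_restrictTableau (hd : ∀ i, n + 1 ≤ i → d i = 0)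
    {T : SemistandardYoungTableau μ} (hT : weight T = d) (hκ : shapeBelow n T = κ)
    (hle : κ ≤ μ) :
    weight (restrictTableau hle T) = d.erase n ∧ μ.card - κ.card = d n := by
  have h1 := weight_eq_add_single (n := n) hle T (restrictTableau hle T)
    (fun i j hc => (restrictTableau_apply hle T hc).symm) (fun i j hc hc' => by
      have h2 := entry_lt_of_weight hd hT hc
      have h3 : ¬ T i j < n := fun h => hc' (hκ ▸ mem_shapeBelow.2 ⟨hc, h⟩)
      simp only at h2
      omega)
  have h0 : weight (restrictTableau hle T) n = 0 := by
    refine weight_apply_eq_zero _ fun c hc => ?_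
    rw [restrictTableau_apply hle T hc]
    rw [← hκ] at hc
    exact (mem_shapeBelow.1 hc).2.ne
  rw [hT] at h1
  constructor
  · ext i
    by_cases hi : i = n
    · rw [hi, h0, Finsupp.erase_same]
    · rw [Finsupp.erase_ne hi, h1, Finsupp.add_apply, Finsupp.single_eq_of_ne hi, add_zero]
  · rw [h1, Finsupp.add_apply, h0, Finsupp.single_eq_same, zero_add]

/-- Tableaux of shape `μ` whose entries smaller than `n` fill `κ`, and all others are `n`,
correspond to tableaux of shape `κ`. -/
def branchingEquiv (hd : ∀ i, n + 1 ≤ i → d i = 0) (hs : HStrip κ μ)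
    (ha : μ.card - κ.card = d n) :
    {T : {T : SemistandardYoungTableau μ // weight T = d} // shapeBelow n T.1 = κ} ≃
      {T : SemistandardYoungTableau κ // weight T = d.erase n} where
  toFun T := ⟨restrictTableau hs.le T.1.1, (weight_restrictTableau hd T.1.2 T.2 hs.le).1⟩
  invFun T :=
    have hd' : ∀ i, n ≤ i → d.erase n i = 0 := fun i hi => by
      rcases hi.eq_or_lt with rfl | hi
      · exact Finsupp.erase_same
      · rw [Finsupp.erase_ne hi.ne', hd i hi]
    have hT : ∀ i j, (i, j) ∈ κ → T.1 i j < n := fun i j hc => entry_lt_of_weight hd' T.2 hc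
    ⟨⟨extendTableau hs T.1 hT, by
      rw [weight_eq_add_single hs.le (extendTableau hs T.1 hT) T.1
        (fun i j hc => extendTableau_apply_of_mem hs T.1 hT hc)
        (fun i j hc hc' => extendTableau_apply_of_notMem hs T.1 hT hc hc'), T.2, ha]
      exact Finsupp.erase_add_single n d⟩, by
      apply YoungDiagram.ext
      ext ⟨i, j⟩
      rw [YoungDiagram.mem_cells, mem_shapeBelow, YoungDiagram.mem_cells]
      constructor
      · rintro ⟨h1, h2⟩
        by_contra h3
        rw [extendTableau_apply_of_notMem hs T.1 hT h1 h3] at h2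
        exact lt_irrefl _ h2
      · intro h
        refine ⟨hs.le h, ?_⟩
        rw [extendTableau_apply_of_mem hs T.1 hT h]
        exact hT i j h⟩
  left_inv := by
    rintro ⟨⟨T, hT⟩, hκ⟩
    refine Subtype.ext (Subtype.ext (SemistandardYoungTableau.ext fun i j => ?_))
    by_cases h1 : (i, j) ∈ κ
    · rw [extendTableau_apply_of_mem _ _ _ h1, restrictTableau_apply _ _ h1]
    · by_cases h2 : (i, j) ∈ μ
      · rw [extendTableau_apply_of_notMem _ _ _ h2 h1]
        have h3 := entry_lt_of_weight hd hT h2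
        have h4 : ¬ T i j < n := fun h => h1 (hκ ▸ mem_shapeBelow.2 ⟨h2, h⟩)
        change n = T i j
        simp only at h3
        omega
      · rw [SemistandardYoungTableau.zeros _ h2, SemistandardYoungTableau.zeros _ h2]
  right_inv := by
    rintro ⟨T, hT⟩
    refine Subtype.ext (SemistandardYoungTableau.ext fun i j => ?_)
    by_cases h1 : (i, j) ∈ κ
    · rw [restrictTableau_apply _ _ h1, extendTableau_apply_of_mem _ _ _ h1]
    · rw [SemistandardYoungTableau.zeros _ h1, SemistandardYoungTableau.zeros _ h1]

/-- Tableaux are sorted by the shape of their entries below n; columns being strict, the entries n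
fill a horizontal strip, of d n cells. -/
theorem card_tableaux_branching (hd : ∀ i, n + 1 ≤ i → d i = 0) :
    Nat.card {T : SemistandardYoungTableau μ // weight T = d} =
      ∑ κ ∈ stripsBelow μ, if μ.card - κ.card = d n then
        Nat.card {T : SemistandardYoungTableau κ // weight T = d.erase n} else 0 := by
  classical
  have := finite_tableaux μ d
  have := Fintype.ofFinite {T : SemistandardYoungTableau μ // weight T = d}
  rw [Nat.card_eq_fintype_card, ← Finset.card_univ, Finset.card_eq_sum_card_fiberwise
    (f := fun T => shapeBelow n T.1) (t := stripsBelow μ) fun T _ => mem_stripsBelow.2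
      (hStrip_shapeBelow fun c hc => entry_lt_of_weight hd T.2 hc)]
  refine Finset.sum_congr rfl fun κ hκ => ?_
  have hs := mem_stripsBelow.1 hκ
  split_ifs with ha
  · rw [← Nat.card_congr (branchingEquiv hd hs ha), Nat.card_eq_fintype_card, Fintype.card_subtype]
  · rw [Finset.card_eq_zero, Finset.filter_eq_empty_iff]
    exact fun T _ hT => ha (weight_restrictTableau hd T.2 hT hs.le).2

end Branching

theorem coeff_X_pow_mul_of_lt (n a : ℕ) (F : MvPowerSeries ℕ ℚ) (d : ℕ →₀ ℕ) :
    MvPowerSeries.coeff d (MvPowerSeries.X n ^ a * F) =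
      if a ≤ d n then MvPowerSeries.coeff (d - Finsupp.single n a) F else 0 := by
  rw [MvPowerSeries.X_pow_eq, MvPowerSeries.coeff_monomial_mul, one_mul]
  exact if_congr Finsupp.single_le_iff rfl rfl

theorem coeff_schurPoly_eq_zero (n : ℕ) (μ : YoungDiagram) (d : ℕ →₀ ℕ) {i : ℕ} (hi : n ≤ i)
    (hd : d i ≠ 0) :
    MvPowerSeries.coeff d (schurPoly (MvPowerSeries.X : ℕ → MvPowerSeries ℕ ℚ) n μ) = 0 := by
  classical
  induction n generalizing d μ with
  | zero =>
    rw [schurPoly]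
    split_ifs
    · rw [MvPowerSeries.coeff_one, if_neg]
      rintro rfl
      exact hd rfl
    · exact map_zero _
  | succ n ih =>
    rw [schurPoly, map_sum]
    refine Finset.sum_eq_zero fun κ _ => ?_
    rw [coeff_X_pow_mul_of_lt]
    split_ifs
    · refine ih _ _ (by omega) ?_
      rwa [Finsupp.tsub_apply, Finsupp.single_eq_of_ne (by omega), tsub_zero]
    · rfl

theorem coeff_schurPoly (n : ℕ) (μ : YoungDiagram) (d : ℕ →₀ ℕ) (hd : ∀ i, n ≤ i → d i = 0) :
    MvPowerSeries.coeff d (schurPoly (MvPowerSeries.X : ℕ → MvPowerSeries ℕ ℚ) n μ) =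
      Nat.card {T : SemistandardYoungTableau μ // weight T = d} := by
  classical
  induction n generalizing d μ with
  | zero =>
    have hd0 : d = 0 := Finsupp.ext fun i => hd i (Nat.zero_le i)
    subst hd0
    rw [schurPoly]
    split_ifs with h
    · subst h
      have hw : ∀ T : SemistandardYoungTableau (⊥ : YoungDiagram), weight T = 0 :=
        fun T => Finset.sum_empty
      have hu : Nat.card {T : SemistandardYoungTableau (⊥ : YoungDiagram) // weight T = 0} = 1 := by
        rw [Nat.card_eq_one_iff_unique]
        refine ⟨⟨fun T T' => Subtype.ext (SemistandardYoungTableau.ext fun i j => ?_)⟩,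
          ⟨default, hw _⟩⟩
        rw [T.1.zeros (YoungDiagram.notMem_bot _), T'.1.zeros (YoungDiagram.notMem_bot _)]
      rw [hu, MvPowerSeries.coeff_zero_one, Nat.cast_one]
    · have he : IsEmpty {T : SemistandardYoungTableau μ // weight T = 0} := by
        refine ⟨fun T => h ?_⟩
        by_contra hne
        have hcard : μ.card ≠ 0 := fun h0 => hne (card_eq_zero_iff.1 h0)
        obtain ⟨c, hc⟩ := Finset.card_ne_zero.1 hcard
        exact weight_apply_ne_zero T.1 hc (by rw [T.2]; rfl)
      rw [Nat.card_of_isEmpty, map_zero, Nat.cast_zero]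
  | succ n ih =>
    rw [schurPoly, map_sum, card_tableaux_branching hd, Nat.cast_sum]
    refine Finset.sum_congr rfl fun κ _ => ?_
    rw [coeff_X_pow_mul_of_lt]
    have herase : d - Finsupp.single n (d n) = d.erase n := by
      ext i
      by_cases hi : i = n
      · rw [hi, Finsupp.tsub_apply, Finsupp.single_eq_same, Finsupp.erase_same, Nat.sub_self]
      · rw [Finsupp.tsub_apply, Finsupp.single_eq_of_ne hi, Finsupp.erase_ne hi, tsub_zero]
    -- A strip with fewer than d n cells leaves a power of x_n that the earlier variables cannot
    -- supply; one with more overshoots the exponent.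
    rcases lt_trichotomy (μ.card - κ.card) (d n) with h | h | h
    · rw [if_pos h.le, if_neg h.ne, Nat.cast_zero]
      refine coeff_schurPoly_eq_zero n κ _ le_rfl ?_
      rw [Finsupp.tsub_apply, Finsupp.single_eq_same]
      omega
    · rw [if_pos h.le, if_pos h, h, herase]
      refine ih _ _ fun i hi => ?_
      rcases hi.eq_or_lt with rfl | hi
      · exact Finsupp.erase_same
      · rw [Finsupp.erase_ne hi.ne', hd i hi]
    · rw [if_neg (by omega), if_neg h.ne', Nat.cast_zero]

/-! ### Symmetric functions are determined by their values in finitely many variables -/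

theorem coeff_toSeries (f : Sym ℚ) (n : ℕ) (d : ℕ →₀ ℕ) (hd : ∀ i, n ≤ i → d i = 0) :
    MvPowerSeries.coeff d (toSeries f) =
      MvPowerSeries.coeff d (evalVars (MvPowerSeries.X : ℕ → MvPowerSeries ℕ ℚ) n f) := by
  classical
  induction f using MvPolynomial.induction_on generalizing d with
  | C a =>
    rw [← MvPolynomial.algebraMap_eq, AlgHom.commutes, AlgHom.commutes]
  | add p q hp hq => rw [map_add, map_add, map_add, map_add, hp d hd, hq d hd]
  | mul_X p r hp =>
    rw [map_mul toSeries, map_mul (evalVars _ n), MvPowerSeries.coeff_mul, MvPowerSeries.coeff_mul]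
    refine Finset.sum_congr rfl fun e he => ?_
    rw [Finset.HasAntidiagonal.mem_antidiagonal] at he
    have he' : ∀ i, e.1 i + e.2 i = d i := fun i => by rw [← he, Finsupp.add_apply]
    rw [hp e.1 fun i hi => by have := he' i; have := hd i hi; omega, evalVars_X, toSeries,
      MvPolynomial.aeval_X, map_sum]
    congr 1
    simp only [MvPowerSeries.coeff_X_pow]
    change powerSumSeries r e.2 = _
    unfold powerSumSeries
    split_ifs with h
    · obtain ⟨i, hi⟩ := h
      have hin : i < n := by
        by_contra! hni
        have h1 := he' i
        rw [hi, hd i hni, Finsupp.single_eq_same] at h1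
        have := r.pos
        omega
      rw [hi, Finset.sum_eq_single i]
      · rw [if_pos rfl]
      · intro j _ hj
        exact if_neg fun h => hj ((Finsupp.single_left_inj r.ne_zero).1 h).symm
      · exact fun h => absurd (Finset.mem_range.2 hin) h
    · exact (Finset.sum_eq_zero fun i _ => if_neg fun hi => h ⟨i, hi⟩).symm

theorem exists_bound (d : ℕ →₀ ℕ) : ∃ n, ∀ i, n ≤ i → d i = 0 := by
  refine ⟨d.support.sup id + 1, fun i hi => ?_⟩
  by_contra h
  have := Finset.le_sup (f := id) (Finsupp.mem_support_iff.2 h)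
  simp only [id_eq] at this
  omega

/-- Each exponent involves finitely many variables, so truncation loses nothing once n is large
enough. -/
theorem ext_evalVars {f g : Sym ℚ}
    (h : ∀ n, evalVars (MvPowerSeries.X : ℕ → MvPowerSeries ℕ ℚ) n f =
      evalVars MvPowerSeries.X n g) : f = g := by
  refine toSeries_injective (MvPowerSeries.ext fun d => ?_)
  obtain ⟨n, hn⟩ := exists_bound d
  rw [coeff_toSeries f n d hn, coeff_toSeries g n d hn, h]

theorem toSeries_eq_schurSeries {f : Sym ℚ} {μ : YoungDiagram}
    (h : ∀ n, evalVars (MvPowerSeries.X : ℕ → MvPowerSeries ℕ ℚ) n f =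
      schurPoly MvPowerSeries.X n μ) : toSeries f = schurSeries μ := by
  refine MvPowerSeries.ext fun d => ?_
  obtain ⟨n, hn⟩ := exists_bound d
  rw [coeff_toSeries f n d hn, h, coeff_schurPoly n μ d hn]
  rfl

/-! ### Existence of Schur functions -/

theorem stripsBelow_bot : stripsBelow ⊥ = {⊥} := by
  ext κ
  rw [mem_stripsBelow, Finset.mem_singleton]
  constructor
  · intro h
    exact le_bot_iff.1 h.le
  · rintro rfl
    exact hStrip_iff_rowLen.2 fun i => by simp [rowLen_bot]

theorem schurPoly_bot {R : Type*} [CommRing R] (x : ℕ → R) (n : ℕ) : schurPoly x n ⊥ = 1 := by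
  induction n with
  | zero => rw [schurPoly, if_pos rfl]
  | succ n ih => rw [schurPoly, stripsBelow_bot, Finset.sum_singleton, ih, Nat.sub_self, pow_zero,
      one_mul]

theorem exists_removeLastRow {μ : YoungDiagram} {k : ℕ} (hk : μ.rowLen (k + 1) = 0) :
    ∃ ν : YoungDiagram, ν.rowLen k = 0 ∧ (∀ i, i ≠ k → ν.rowLen i = μ.rowLen i) ∧ HStrip ν μ ∧
      μ.card = ν.card + μ.rowLen k := by
  have hex := exists_rowLen_eq (fun i => if i = k then 0 else μ.rowLen i) (fun i => by
    have := μ.rowLen_anti i (i + 1) (Nat.le_succ i)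
    by_cases hi : i = k
    · subst hi
      simp [hk]
    · simp only [hi, if_false]
      split_ifs <;> omega) (n := k) (if_pos rfl)
  obtain ⟨ν, hν⟩ := hex
  have hνk : ν.rowLen k = 0 := by rw [hν, if_pos rfl]
  refine ⟨ν, hνk, fun i hi => by rw [hν, if_neg hi], hStrip_iff_rowLen.2 fun i => ?_, ?_⟩
  · have := μ.rowLen_anti i (i + 1) (Nat.le_succ i)
    rw [hν]
    split_ifs with hi
    · subst hi; omega
    · omega
  · rw [card_eq_sum_rowLen hk, card_eq_sum_rowLen hνk, Finset.sum_range_succ]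
    congr 1
    exact Finset.sum_congr rfl fun i hi => by
      rw [hν, if_neg (Finset.mem_range.1 hi).ne]

/-- Pieri's formula is triangular. If ν is μ without its last row, of length m, then h_m s_ν
contains s_μ once, and its other terms have no more rows and a shorter row in that position.
Induction on the number of rows, then on m, expresses s_μ. -/
theorem exists_evalVars_eq_schurPoly (μ : YoungDiagram) :
    ∃ f : Sym ℚ, ∀ n, evalVars (MvPowerSeries.X : ℕ → MvPowerSeries ℕ ℚ) n f =
      schurPoly MvPowerSeries.X n μ := by
  classical
  suffices H : ∀ k (μ : YoungDiagram), μ.rowLen k = 0 →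
      ∃ f : Sym ℚ, ∀ n, evalVars (MvPowerSeries.X : ℕ → MvPowerSeries ℕ ℚ) n f =
        schurPoly MvPowerSeries.X n μ from H _ μ (rowLen_card μ)
  clear μ
  intro k
  induction k with
  | zero =>
    intro μ hμ
    have h1 : μ = ⊥ := diagram_ext_rowLen fun i => by
      rw [rowLen_bot, rowLen_eq_zero_of_le hμ (Nat.zero_le i)]
    exact ⟨1, fun n => by rw [map_one, h1, schurPoly_bot]⟩
  | succ k ih =>
    suffices H : ∀ m (μ : YoungDiagram), μ.rowLen (k + 1) = 0 → μ.rowLen k = m →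
        ∃ f : Sym ℚ, ∀ n, evalVars (MvPowerSeries.X : ℕ → MvPowerSeries ℕ ℚ) n f =
          schurPoly MvPowerSeries.X n μ from fun μ hμ => H _ μ hμ rfl
    intro m
    induction m using Nat.strong_induction_on with
    | _ m ihm =>
      intro μ hμ hm
      obtain ⟨ν, hνk, hν, hs, hc⟩ := exists_removeLastRow hμ
      rw [hm] at hc
      obtain ⟨g, hg⟩ := ih ν hνk
      have hμmem : μ ∈ stripsAbove ν m := mem_stripsAbove.2 ⟨hc, hs⟩
      have hrest : ∀ l, l ∈ (stripsAbove ν m).erase μ →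
          ∃ f : Sym ℚ, ∀ n, evalVars (MvPowerSeries.X : ℕ → MvPowerSeries ℕ ℚ) n f =
            schurPoly MvPowerSeries.X n l := by
        intro l hl
        obtain ⟨hne, hl⟩ := Finset.mem_erase.1 hl
        obtain ⟨hlc, hls⟩ := mem_stripsAbove.1 hl
        have hls' := hStrip_iff_rowLen.1 hls
        have hl0 : l.rowLen (k + 1) = 0 := Nat.le_zero.1 (hνk ▸ (hls' k).1)
        refine ihm _ ?_ l hl0 rfl
        -- Were row k of `l` at least m, then `l` would contain μ and have the same size.
        by_contra! hle
        refine hne (eq_of_le_of_card_le (le_iff_rowLen.2 fun i => ?_) (by omega)).symm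
        by_cases hi : i = k
        · rw [hi, hm]
          exact hle
        · rw [← hν i hi]
          exact (hls' i).2
      choose! F hF using hrest
      refine ⟨complete m * g - ∑ l ∈ (stripsAbove ν m).erase μ, F l, fun n => ?_⟩
      rw [map_sub, map_mul, hg, complete_mul_schurPoly, map_sum,
        Finset.sum_congr rfl fun l hl => hF l hl n, ← Finset.add_sum_erase _ _ hμmem,
        add_sub_cancel_right]

theorem evalVars_schurRat (n : ℕ) (μ : YoungDiagram) :
    evalVars (MvPowerSeries.X : ℕ → MvPowerSeries ℕ ℚ) n (schurRat μ) =
      schurPoly MvPowerSeries.X n μ := by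
  obtain ⟨f, hf⟩ := exists_evalVars_eq_schurPoly μ
  -- Existence rules out the default value 0, and injectivity identifies the chosen element.
  have h1 : ∃ f : Sym ℚ, toSeries f = schurSeries μ := ⟨f, toSeries_eq_schurSeries hf⟩
  have h2 : schurRat μ = f := by
    apply toSeries_injective
    rw [schurRat, dif_pos h1, h1.choose_spec, toSeries_eq_schurSeries hf]
  rw [h2, hf]

/-! ### Schur functions of small shapes -/

theorem schurRat_row {μ : YoungDiagram} (h1 : μ.rowLen 1 = 0) :
    schurRat μ = complete (μ.rowLen 0) := by
  have hμc : μ.card = μ.rowLen 0 := by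
    rw [card_eq_sum_rowLen h1, Finset.sum_range_one]
  have hset : stripsAbove ⊥ (μ.rowLen 0) = {μ} := by
    ext l
    rw [mem_stripsAbove, Finset.mem_singleton, card_eq_zero_iff.2 rfl, zero_add]
    constructor
    · rintro ⟨hc, hs⟩
      have hl1 : l.rowLen 1 = 0 := by
        have := (hStrip_iff_rowLen.1 hs 0).1
        rwa [rowLen_bot, Nat.le_zero] at this
      rw [card_eq_sum_rowLen hl1, Finset.sum_range_one] at hc
      refine diagram_ext_rowLen fun i => ?_
      cases i with
      | zero => exact hc
      | succ i =>
        rw [rowLen_eq_zero_of_le hl1 (by omega), rowLen_eq_zero_of_le h1 (by omega)]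
    · rintro rfl
      refine ⟨hμc, hStrip_iff_rowLen.2 fun i => ?_⟩
      rw [rowLen_bot, rowLen_eq_zero_of_le h1 (by omega)]
      exact ⟨le_rfl, Nat.zero_le _⟩
  refine ext_evalVars fun n => ?_
  have h2 := complete_mul_schurPoly (MvPowerSeries.X : ℕ → MvPowerSeries ℕ ℚ) n (μ.rowLen 0) ⊥
  rw [hset, Finset.sum_singleton, schurPoly_bot, mul_one] at h2
  rw [evalVars_schurRat, h2]

theorem exists_row (a : ℕ) : ∃ μ : YoungDiagram, μ.rowLen 0 = a ∧ μ.rowLen 1 = 0 := by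
  obtain ⟨μ, hμ⟩ := exists_rowLen_eq (fun i => if i = 0 then a else 0)
    (fun i => by rw [if_neg (Nat.succ_ne_zero i)]; exact Nat.zero_le _) (n := 1)
    (if_neg one_ne_zero)
  exact ⟨μ, hμ 0, hμ 1⟩

theorem rowLen_ofRowLens_of_length_le {w : List ℕ} (hw : w.SortedGE) {i : ℕ}
    (hi : w.length ≤ i) : (YoungDiagram.ofRowLens w hw).rowLen i = 0 := by
  by_contra h
  obtain ⟨h1, -⟩ := YoungDiagram.mem_ofRowLens.1
    (YoungDiagram.mem_iff_lt_rowLen.2 (Nat.pos_of_ne_zero h))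
  exact absurd h1 (by simpa using hi)

theorem schurRat_two : schurRat two = complete 2 := by
  have h0 : two.rowLen 0 = 2 := YoungDiagram.rowLen_ofRowLens (w := [2]) (0 : Fin 1)
  have h1 : two.rowLen 1 = 0 := rowLen_ofRowLens_of_length_le _ le_rfl
  rw [schurRat_row h1, h0]

/-- A cell added to the row (a) gives (a + 1) or (a, 1), so Pieri reads h_a h_1 = s_{(a+1)} +
s_{(a,1)}. -/
theorem schurRat_twoRows_one (a : ℕ) (ha : 1 ≤ a) :
    schurRat (twoRows a 1 ha) = complete a * complete 1 - complete (a + 1) := by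
  classical
  have h0 : (twoRows a 1 ha).rowLen 0 = a :=
    YoungDiagram.rowLen_ofRowLens (w := [a, 1]) (0 : Fin 2)
  have h1 : (twoRows a 1 ha).rowLen 1 = 1 :=
    YoungDiagram.rowLen_ofRowLens (w := [a, 1]) (1 : Fin 2)
  have h2 : (twoRows a 1 ha).rowLen 2 = 0 := rowLen_ofRowLens_of_length_le _ le_rfl
  have hc : (twoRows a 1 ha).card = a + 1 := by
    rw [card_eq_sum_rowLen h2, Finset.sum_range_succ, Finset.sum_range_one, h0, h1]
  obtain ⟨ρ, hρ0, hρ1⟩ := exists_row a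
  obtain ⟨σ, hσ0, hσ1⟩ := exists_row (a + 1)
  have hρc : ρ.card = a := by rw [card_eq_sum_rowLen hρ1, Finset.sum_range_one, hρ0]
  have hσc : σ.card = a + 1 := by rw [card_eq_sum_rowLen hσ1, Finset.sum_range_one, hσ0]
  have hset : stripsAbove ρ 1 = {σ, twoRows a 1 ha} := by
    ext l
    rw [mem_stripsAbove, Finset.mem_insert, Finset.mem_singleton, hρc]
    constructor
    · rintro ⟨hlc, hs⟩
      have hs' := hStrip_iff_rowLen.1 hs
      have hl2 : l.rowLen 2 = 0 := Nat.le_zero.1 (hρ1 ▸ (hs' 1).1)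
      have hsum := hlc
      rw [card_eq_sum_rowLen hl2, Finset.sum_range_succ, Finset.sum_range_one] at hsum
      have h3 := (hs' 0).2
      rw [hρ0] at h3
      have hext : ∀ τ : YoungDiagram, τ.rowLen 2 = 0 → τ.rowLen 0 = l.rowLen 0 →
          τ.rowLen 1 = l.rowLen 1 → l = τ := by
        intro τ hτ2 hτ0 hτ1
        refine diagram_ext_rowLen fun i => ?_
        match i with
        | 0 => exact hτ0.symm
        | 1 => exact hτ1.symm
        | i + 2 =>
          rw [rowLen_eq_zero_of_le hl2 (by omega), rowLen_eq_zero_of_le hτ2 (by omega)]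
      by_cases hl1 : l.rowLen 1 = 0
      · exact Or.inl (hext σ (rowLen_eq_zero_of_le hσ1 (by omega)) (by omega) (by omega))
      · exact Or.inr (hext _ h2 (by omega) (by omega))
    · rintro (rfl | rfl)
      · refine ⟨hσc, hStrip_of_card_eq_succ (le_iff_rowLen.2 fun i => ?_) (by omega)⟩
        cases i with
        | zero => omega
        | succ i => rw [rowLen_eq_zero_of_le hρ1 (by omega)]; exact Nat.zero_le _
      · refine ⟨hc, hStrip_of_card_eq_succ (le_iff_rowLen.2 fun i => ?_) (by omega)⟩
        cases i with
        | zero => omega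
        | succ i => rw [rowLen_eq_zero_of_le hρ1 (by omega)]; exact Nat.zero_le _
  have hne : σ ≠ twoRows a 1 ha := fun h => by rw [h, h1] at hσ1; omega
  refine ext_evalVars fun n => ?_
  have h3 := complete_mul_schurPoly (MvPowerSeries.X : ℕ → MvPowerSeries ℕ ℚ) n 1 ρ
  rw [hset, Finset.sum_pair hne, ← evalVars_schurRat, ← evalVars_schurRat, ← evalVars_schurRat,
    schurRat_row hρ1, schurRat_row hσ1, hρ0, hσ0] at h3
  rw [map_sub, map_mul]
  linear_combination -h3

theorem schurRat_oneOne : schurRat oneOne = complete 1 ^ 2 - complete 2 := by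
  rw [oneOne, schurRat_twoRows_one, pow_two]

/-! ### Plethysm -/

/-- The plethysm `f ↦ f[g]` over `ℚ` as an algebra endomorphism. -/
def plethysmHom (g : Sym ℚ) : Sym ℚ →ₐ[ℚ] Sym ℚ :=
  MvPolynomial.aeval fun r => powerSumPlethysm r g

theorem plethysm_baseChange (K : Type*) [CommRing K] [Algebra ℚ K] (f g : Sym ℚ) :
    plethysm (baseChange K f) g = baseChange K (plethysmHom g f) := by
  induction f using MvPolynomial.induction_on with
  | C a =>
    simp only [plethysm, baseChange, plethysmHom, MvPolynomial.map_C, MvPolynomial.aeval_C,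
      MvPolynomial.algebraMap_eq]
  | add p q hp hq =>
    simp only [plethysm, baseChange, map_add] at hp hq ⊢
    rw [hp, hq]
  | mul_X p r hp =>
    simp only [plethysm, baseChange, map_mul] at hp ⊢
    rw [hp, MvPolynomial.map_X, MvPolynomial.aeval_X, plethysmHom, MvPolynomial.aeval_X]

theorem powerSumPlethysm_complete_one_sq_sub (r : ℕ+) :
    powerSumPlethysm r (complete 1 ^ 2 - complete 2) =
      MvPolynomial.X r ^ 2 -
        MvPolynomial.C (1 / 2) * (MvPolynomial.X r ^ 2 + MvPolynomial.X (r * 2)) := by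
  rw [powerSumPlethysm, complete_one, complete_two]
  simp only [map_sub, map_pow, map_mul, map_add, MvPolynomial.aeval_X, mul_one,
    MvPolynomial.aeval_C, MvPolynomial.algebraMap_eq]

theorem powerSumPlethysm_complete_two (r : ℕ+) :
    powerSumPlethysm r (complete 2) =
      MvPolynomial.C (1 / 2) * (MvPolynomial.X r ^ 2 + MvPolynomial.X (r * 2)) := by
  rw [powerSumPlethysm, complete_two]
  simp only [map_pow, map_mul, map_add, MvPolynomial.aeval_X, mul_one,
    MvPolynomial.aeval_C, MvPolynomial.algebraMap_eq]

/-! ### The two plethysms in finitely many variables -/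

section Evaluation

variable {R : Type*} [CommRing R]

open Classical in
-- The subtracted sum stands for h_h[e_2] or h_h[h_2] and meets even shapes only, whence b_ν - 1.
-- The function `S` is left free to serve for conjugate shapes too.
theorem sum_multiplicities (s : Finset YoungDiagram) (S : YoungDiagram → R) :
    ∑ μ ∈ s, ((if HasTwoDistinctOddColumns μ then 1 else 0) +
        if IsEven μ then numCorners μ else 0) • S μ - ∑ ν ∈ s.filter IsEven, S ν =
      ∑ μ ∈ s.filter HasTwoDistinctOddColumns, S μ +
        ∑ ν ∈ s.filter IsEven, ((numCorners ν : R) - 1) * S ν := by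
  have h1 : ∀ μ : YoungDiagram, ((if HasTwoDistinctOddColumns μ then 1 else 0) +
      if IsEven μ then numCorners μ else 0) • S μ =
      (if HasTwoDistinctOddColumns μ then S μ else 0) +
        if IsEven μ then (numCorners μ : R) * S μ else 0 := by
    intro μ
    rw [add_nsmul]
    split_ifs <;> simp
  simp only [h1, sub_mul, one_mul]
  rw [Finset.sum_add_distrib, ← Finset.sum_filter, ← Finset.sum_filter, Finset.sum_sub_distrib]
  ring

theorem sum_partitions_transpose (N : ℕ) (F : YoungDiagram → R) :
    ∑ μ ∈ partitions N, F μ = ∑ μ ∈ partitions N, F μ.transpose := by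
  refine Finset.sum_nbij' YoungDiagram.transpose YoungDiagram.transpose
    (fun μ h => transpose_mem_partitions.2 h) (fun μ h => transpose_mem_partitions.2 h)
    (fun μ _ => μ.transpose_transpose) (fun μ _ => μ.transpose_transpose) fun μ _ => ?_
  rw [μ.transpose_transpose]

variable [Algebra ℚ R]

/-- Both sides are homomorphisms, and p_r[e_2] = (p_r² - p_{2r})/2. -/
theorem evalVars_plethysmHom_elementary_two (x : ℕ → R) (n : ℕ) (f : Sym ℚ) :
    evalVars x n (plethysmHom (complete 1 ^ 2 - complete 2) f) = evalPairs x n f := by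
  have h : (evalVars x n).comp (plethysmHom (complete 1 ^ 2 - complete 2)) = evalPairs x n := by
    refine MvPolynomial.algHom_ext fun r => ?_
    rw [AlgHom.comp_apply, plethysmHom, MvPolynomial.aeval_X, evalPairs, MvPolynomial.aeval_X,
      powerSumPlethysm_complete_one_sq_sub]
    simp only [map_sub, map_pow, map_mul, map_add, ← MvPolynomial.algebraMap_eq, AlgHom.commutes]
    linear_combination -(evalVars x n (MvPolynomial.X r) ^ 2) * half_mul_two (R := R)
  exact DFunLike.congr_fun h f

theorem evalVars_plethysmHom_complete_two (x : ℕ → R) (n : ℕ) (f : Sym ℚ) :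
    evalVars x n (plethysmHom (complete 2) f) = evalMultipairs x n f := by
  have h : (evalVars x n).comp (plethysmHom (complete 2)) = evalMultipairs x n := by
    refine MvPolynomial.algHom_ext fun r => ?_
    rw [AlgHom.comp_apply, plethysmHom, MvPolynomial.aeval_X, evalMultipairs,
      MvPolynomial.aeval_X, powerSumPlethysm_complete_two]
    simp only [map_pow, map_mul, map_add, ← MvPolynomial.algebraMap_eq, AlgHom.commutes]
  exact DFunLike.congr_fun h f

theorem plethysmHom_complete_one (g : Sym ℚ) : plethysmHom g (complete 1) = g := by
  rw [complete_one, plethysmHom, MvPolynomial.aeval_X, powerSumPlethysm]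
  simp only [one_mul]
  exact DFunLike.congr_fun MvPolynomial.aeval_X_left g

open Classical in
-- Littlewood expands h_m[e_2] and h_{m+1}[e_2], Pieri multiplies the former by e_2, and exchanging
-- the sums leaves the count of even shapes obtained by removing a vertical strip.
theorem evalPairs_hook (x : ℕ → R) (n m : ℕ) :
    evalPairs x n (complete m * complete 1 - complete (m + 1)) =
      ∑ μ ∈ (partitions (2 * (m + 1))).filter HasTwoDistinctOddColumns, schurPoly x n μ +
        ∑ ν ∈ (partitions (2 * (m + 1))).filter IsEven,
          ((numCorners ν : R) - 1) * schurPoly x n ν := by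
  have h1 : ∑ μ ∈ partitions (2 * (m + 1)), ((if HasTwoDistinctOddColumns μ then 1 else 0) +
      if IsEven μ then numCorners μ else 0) • schurPoly x n μ =
      ∑ μ ∈ partitions (2 * (m + 1)), ∑ ν ∈ (partitions (2 * m)).filter
        (fun ν => IsEven ν ∧ VStrip ν μ), schurPoly x n μ := by
    refine Finset.sum_congr rfl fun μ hμ => ?_
    rw [Finset.sum_const, card_even_removals (by rw [mem_partitions.1 hμ, mul_add, mul_one])]
  rw [← sum_multiplicities, h1, map_sub, map_mul, evalPairs_complete x n m,
    evalPairs_complete x n (m + 1),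
    ← evalVars_plethysmHom_elementary_two x n (complete 1), plethysmHom_complete_one,
    mul_comm, Finset.mul_sum,
    Finset.sum_congr rfl fun ν _ => elementary_two_mul_schurPoly x n ν]
  congr 1
  refine Finset.sum_comm' fun ν μ => ?_
  simp only [Finset.mem_filter, mem_partitions]
  constructor
  · rintro ⟨⟨h1, h2⟩, h3, h4⟩
    exact ⟨⟨h1, h2, h4⟩, by omega⟩
  · rintro ⟨⟨h1, h2, h4⟩, h3⟩
    exact ⟨⟨h1, h2⟩, by omega, h4⟩

open Classical in
-- The same argument with even rows and horizontal strips; reindexing by conjugation brings it to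
-- the same multiplicities.
theorem evalMultipairs_hook (x : ℕ → R) (n m : ℕ) :
    evalMultipairs x n (complete m * complete 1 - complete (m + 1)) =
      ∑ μ ∈ (partitions (2 * (m + 1))).filter HasTwoDistinctOddColumns,
          schurPoly x n μ.transpose +
        ∑ ν ∈ (partitions (2 * (m + 1))).filter IsEven,
          ((numCorners ν : R) - 1) * schurPoly x n ν.transpose := by
  have h1 : ∑ μ ∈ partitions (2 * (m + 1)), ((if HasTwoDistinctOddColumns μ then 1 else 0) +
      if IsEven μ then numCorners μ else 0) • schurPoly x n μ.transpose =
      ∑ μ ∈ partitions (2 * (m + 1)), ∑ ν ∈ (partitions (2 * m)).filter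
        (fun ν => EvenRows ν ∧ HStrip ν μ), schurPoly x n μ := by
    rw [sum_partitions_transpose _ fun μ => ∑ ν ∈ (partitions (2 * m)).filter
      (fun ν => EvenRows ν ∧ HStrip ν μ), schurPoly x n μ]
    refine Finset.sum_congr rfl fun μ hμ => ?_
    rw [Finset.sum_const, card_evenRows_removals (by rw [mem_partitions.1 hμ, mul_add, mul_one])]
  have h2 : ∑ ν ∈ (partitions (2 * (m + 1))).filter IsEven, schurPoly x n ν.transpose =
      ∑ ν ∈ (partitions (2 * (m + 1))).filter EvenRows, schurPoly x n ν := by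
    rw [Finset.sum_filter, Finset.sum_filter,
      sum_partitions_transpose _ fun ν => if EvenRows ν then schurPoly x n ν else 0]
    exact Finset.sum_congr rfl fun ν _ => if_congr evenRows_transpose.symm rfl rfl
  rw [← sum_multiplicities (S := fun μ => schurPoly x n μ.transpose), h1, h2, map_sub, map_mul,
    evalMultipairs_complete x n m,
    evalMultipairs_complete x n (m + 1),
    ← evalVars_plethysmHom_complete_two x n (complete 1), plethysmHom_complete_one,
    mul_comm, Finset.mul_sum, Finset.sum_congr rfl fun ν _ => complete_mul_schurPoly x n 2 ν]
  congr 1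
  refine Finset.sum_comm' fun ν μ => ?_
  simp only [Finset.mem_filter, mem_partitions, mem_stripsAbove]
  constructor
  · rintro ⟨⟨h1, h2⟩, h3, h4⟩
    exact ⟨⟨h1, h2, h4⟩, by omega⟩
  · rintro ⟨⟨h1, h2, h4⟩, h3⟩
    exact ⟨⟨h1, h2⟩, by omega, h4⟩

end Evaluation

/-! ### Return to Λ and base change -/

open Classical in
theorem plethysmHom_hook_elementary_two (m : ℕ) (hm : 1 ≤ m) :
    plethysmHom (schurRat oneOne) (schurRat (twoRows m 1 hm)) =
      ∑ μ ∈ (partitions (2 * (m + 1))).filter HasTwoDistinctOddColumns, schurRat μ +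
        ∑ ν ∈ (partitions (2 * (m + 1))).filter IsEven,
          ((numCorners ν : Sym ℚ) - 1) * schurRat ν := by
  refine ext_evalVars fun n => ?_
  rw [schurRat_oneOne, schurRat_twoRows_one, evalVars_plethysmHom_elementary_two, evalPairs_hook]
  simp only [map_add, map_sum, map_mul, map_sub, map_natCast, map_one, evalVars_schurRat]

open Classical in
theorem plethysmHom_hook_two (m : ℕ) (hm : 1 ≤ m) :
    plethysmHom (schurRat two) (schurRat (twoRows m 1 hm)) =
      ∑ μ ∈ (partitions (2 * (m + 1))).filter HasTwoDistinctOddColumns, schurRat μ.transpose +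
        ∑ ν ∈ (partitions (2 * (m + 1))).filter IsEven,
          ((numCorners ν : Sym ℚ) - 1) * schurRat ν.transpose := by
  refine ext_evalVars fun n => ?_
  rw [schurRat_two, schurRat_twoRows_one, evalVars_plethysmHom_complete_two, evalMultipairs_hook]
  simp only [map_add, map_sum, map_mul, map_sub, map_natCast, map_one, evalVars_schurRat]

theorem natCast_sub_one_smul {K : Type*} [CommRing K] (b : ℕ) (f : Sym K) :
    ((b : K) - 1) • f = ((b : Sym K) - 1) * f := by
  rw [sub_smul, one_smul, Nat.cast_smul_eq_nsmul, nsmul_eq_mul, sub_mul, one_mul]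

end SymmFn

end

open Classical in
theorem mainTheorem5 {K : Type*} [CommRing K] [Algebra ℚ K] (h : ℕ) (hh : 2 ≤ h) :
    SymmFn.plethysm (SymmFn.schur K (SymmFn.twoRows (h - 1) 1 (Nat.le_sub_of_add_le hh)))
        (SymmFn.schurRat SymmFn.oneOne) =
      ∑ μ ∈ (SymmFn.partitions (2 * h)).filter SymmFn.HasTwoDistinctOddColumns,
          SymmFn.schur K μ +
        ∑ ν ∈ (SymmFn.partitions (2 * h)).filter SymmFn.IsEven,
          ((SymmFn.numCorners ν : K) - 1) • SymmFn.schur K ν ∧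
    SymmFn.plethysm (SymmFn.schur K (SymmFn.twoRows (h - 1) 1 (Nat.le_sub_of_add_le hh)))
        (SymmFn.schurRat SymmFn.two) =
      ∑ μ ∈ (SymmFn.partitions (2 * h)).filter SymmFn.HasTwoDistinctOddColumns,
          SymmFn.schur K μ.transpose +
        ∑ ν ∈ (SymmFn.partitions (2 * h)).filter SymmFn.IsEven,
          ((SymmFn.numCorners ν : K) - 1) • SymmFn.schur K ν.transpose := by
  obtain ⟨m, rfl⟩ : ∃ m, h = m + 1 := ⟨h - 1, by omega⟩
  have hm : 1 ≤ m := by omega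
  simp only [Nat.add_sub_cancel, SymmFn.schur, SymmFn.plethysm_baseChange,
    SymmFn.natCast_sub_one_smul]
  constructor
  · rw [SymmFn.plethysmHom_hook_elementary_two m hm]
    simp only [SymmFn.baseChange, map_add, map_sum, map_mul, map_sub, map_natCast, map_one]
  · rw [SymmFn.plethysmHom_hook_two m hm]
    simp only [SymmFn.baseChange, map_add, map_sum, map_mul, map_sub, map_natCast, map_one]
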